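/- **Setting.** A contextual bandit $B$ consists of measurable spaces $\mathcal X$ of contexts and $\mathcal A$ of actions, nonempty sets $\mathcal A(x)\subset\mathcal A$ of allowable actions, and a reward law depending only on $(x,a)$, with mean $f_*(x,a)$; put $f_*(x)=\sup_{a\in\mathcal A(x)}f_*(x,a)$. Assume that for all $x$ and $a\in\mathcal A(x)$ we have $f_*(x,a)\in[0,1]$ and $\ln\mathbb E_{r|x,a}\exp(\rho(r-f_*(x,a)))\le\rho^2/8$ for all $\rho\in\mathbb R$. Let $\Omega$ be a parameter space with prior probability measure $p_0$ and value functions $f(\theta,x,a)\in\mathbb R$, let $a(\theta,x)\in\arg\max_{a\in\mathcal A(x)}f(\theta,x,a)$ and $f(\theta,x)=f(\theta,x,a(\theta,x))$. (All data are measurable.) For $b\ge1$ let $f_b(\theta,x,a)=\max(-b,\min(b,f(\theta,x,a)))$ and $f_b(\theta,x)=f_b(\theta,x,a(\theta,x))$. For $x\in\mathcal X$ and $\Omega'\subset\Omega$, the decoupling coefficient $\mathrm{dc}(x,b,\Omega',B)\in[0,\infty]$ is the smallest $K$ such that for every probability distribution $q$ on $\Omega'$, with $\pi_q$ the law of $a(\theta,x)$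 for $\theta\sim q$, and every $\mu>0$, $$\mathbb E_{\theta\sim q}[f_b(\theta,x,a(\theta,x))-f_*(x,a(\theta,x))]\le\mu\,\mathbb E_{\tilde a\sim\pi_q}\mathbb E_{\theta\sim q}(f_b(\theta,x,\tilde a)-f_*(x,\tilde a))^2+\frac K{4\mu}.$$ **Algorithm.** Let $\eta,\lambda>0$ and $$L(\theta,x,a,r)=\eta(f(\theta,x,a)-r)^2-\lambda\min(b,f(\theta,x)),$$ $$\Delta L(\theta,x,a,r)=\eta[(f(\theta,x,a)-r)^2-(f_*(x,a)-r)^2]-\lambda[\min(b,f(\theta,x))-f_*(x)].$$ In rounds $t=1,\dots,T$ an adversary chooses a context $x_t$ (arbitrarily, possibly depending on the history $S_{t-1}=((x_s,a_s,r_s))_{s<t}$ and at random); given $(S_{t-1},x_t)$, the algorithm draws $\theta_t$ from the restricted posterior $$p(\theta|x_t,S_{t-1})\propto\exp\Big(-\sum_{s<t}L(\theta,x_s,a_s,r_s)\Big)I(\theta\in\Omega_t)\,p_0(\theta),$$ plays $a_t=a(\theta_t,x_t)$, and receives $r_t$, whose law given $(S_{t-1},x_t,a_t)$ is the reward law at $(x_t,a_t)$.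 Here $\Omega_t\subset\Omega$ may depend on $(S_{t-1},x_t)$, $p_0(\Omega_t)>0$ almost surely (so that the posterior exists), and almost surely $\Omega_T\subset\Omega_{T-1}\subset\cdots\subset\Omega_1$. Let $\mathrm{REG}_t=f_*(x_t)-f_*(x_t,a_t)$, $\mathrm{FG}_t=f_b(\theta_t,x_t)-f_*(x_t)$ and $\mathrm{LS}_t=(f_b(\tilde\theta,x_t,a_t)-f_*(x_t,a_t))^2$, where, given $(S_{t-1},x_t)$, $\tilde\theta\sim p(\cdot|x_t,S_{t-1})$ is independent of $a_t$. Let $$Z_T=\mathbb E\,\ln\,\mathbb E_{\tilde\theta\sim p_0}\,I(\tilde\theta\in\Omega_T)\exp\Big(-\sum_{s=1}^T\Delta L(\tilde\theta,x_s,a_s,r_s)\Big)$$ (for $T=0$, $\Omega_0=\Omega$). **Theorem.** Let $b\ge1$, $0<\eta\le1/(b+1)^2$ and $\lambda>0$. Then $Z_T$ is well defined in $[-\infty,\infty)$ (the positive part of the logarithm has finite expectation), and, as inequalities in $(-\infty,\infty]$, $$\sum_{t=1}^T\mathbb E\,\mathrm{REG}_t\le\frac\lambda\eta\,\mathbb E\sum_{t=1}^T\mathrm{dc}(x_t,b,\Omega_t,B)+\frac{0.25\,\eta}\lambda\sum_{t=1}^T\mathbb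 E\,\mathrm{LS}_t-\sum_{t=1}^T\mathbb E\,\mathrm{FG}_t$$ $$\le\frac\lambda\eta\,\mathbb E\sum_{t=1}^T\mathrm{dc}(x_t,b,\Omega_t,B)+1.5\,\lambda(b+1)^2T-\frac{Z_T}\lambda.$$ Moreover, suppose that $b=1$, $\eta=1/4$, that the bandit is linearly embeddable in dimension $K$, that is, $f(\theta,x,a)=w(\theta,x)^\top\phi(x,a)$ and $f_*(x,a)=w_*(x)^\top\phi(x,a)$ for all $\theta$, $x$ and $a\in\mathcal A(x)$, with $\phi(x,a),w(\theta,x),w_*(x)\in\mathbb R^K$, and that almost surely, for every $t\le T$, $f(\theta,x_t,a)\ge-1$ for all $\theta\in\Omega_t$ and $a\in\mathcal A(x_t)$ (as for $\Omega_t=\{\theta:f(\theta,x_s,a)\ge-1\ \forall s\le t,\ a\in\mathcal A(x_s)\}$). Then $$\sum_{t=1}^T\mathbb E\,\mathrm{REG}_t\le4(K+2)T\lambda-\frac{Z_T}\lambda.$$ -/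

import Mathlib

open MeasureTheory ProbabilityTheory
open scoped ENNReal NNReal

noncomputable section

namespace FeelGood

/-- A contextual bandit: the allowable actions at every context, and the law of the reward, which
depends only on the context and the action. -/
structure Bandit (X A : Type*) [MeasurableSpace X] [MeasurableSpace A] where
  actions : X → Set A
  reward : Kernel (X × A) ℝ
  isMarkov : IsMarkovKernel reward

attribute [instance] Bandit.isMarkov

/-- A family of value functions `f θ x a` together with a choice `greedy θ x` of a maximizing
allowable action. -/
structure Model (Θ : Type*) {X A : Type*} [MeasurableSpace Θ] [MeasurableSpace X]
    [MeasurableSpace A] (B : Bandit X A) where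
  f : Θ → X → A → ℝ
  greedy : Θ → X → A
  measurable_f : Measurable fun p : Θ × X × A => f p.1 p.2.1 p.2.2
  measurable_greedy : Measurable fun p : Θ × X => greedy p.1 p.2
  greedy_mem : ∀ θ x, greedy θ x ∈ B.actions x
  le_greedy : ∀ θ x, ∀ a ∈ B.actions x, f θ x a ≤ f θ x (greedy θ x)

/-- The history after `t` rounds: the observed triples (context, action, reward). -/
abbrev History (X A : Type*) (t : ℕ) : Type _ := Fin t → X × A × ℝ

section Bandit

variable {X A : Type*} [MeasurableSpace X] [MeasurableSpace A]

/-- The true value function `f_*(x, a)`, the mean reward. -/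
def Bandit.value (B : Bandit X A) (x : X) (a : A) : ℝ := ∫ r, r ∂(B.reward (x, a))

/-- The optimal value `f_*(x)` over the allowable actions. -/
def Bandit.optValue (B : Bandit X A) (x : X) : ℝ := ⨆ a : B.actions x, B.value x a

/-- For allowable actions, mean rewards lie in `[0, 1]` and
`E exp (ρ (r - f_*(x, a))) ≤ exp (ρ ^ 2 / 8)` for all real `ρ` (variance proxy `1 / 4`). -/
def Bandit.SubGaussianRewards (B : Bandit X A) : Prop :=
  ∀ x, ∀ a ∈ B.actions x,
    HasSubgaussianMGF (fun r : ℝ => r - B.value x a) (1 / 4 : ℝ≥0) (B.reward (x, a)) ∧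
    B.value x a ∈ Set.Icc (0 : ℝ) 1

/-- The law of the reward given the history, the context and the action: it depends only on the
last two. -/
def Bandit.rewardGiven (B : Bandit X A) (t : ℕ) : Kernel (History X A t × X × A) ℝ :=
  B.reward.comap (fun p : History X A t × X × A => p.2) measurable_snd

end Bandit

section Model

variable {Θ X A : Type*} [MeasurableSpace Θ] [MeasurableSpace X] [MeasurableSpace A]
  {B : Bandit X A}

/-- `f θ x`, the maximal value at `x` according to `θ`. -/
def Model.maxValue (M : Model Θ B) (θ : Θ) (x : X) : ℝ := M.f θ x (M.greedy θ x)

/-- The truncated value `f_b(θ, x, a) = max (-b) (min b (f(θ, x, a)))`. -/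
def Model.trunc (M : Model Θ B) (b : ℝ) (θ : Θ) (x : X) (a : A) : ℝ :=
  max (-b) (min b (M.f θ x a))

/-- The truncated maximal value `f_b(θ, x) = f_b(θ, x, a(θ, x))`. -/
def Model.truncMax (M : Model Θ B) (b : ℝ) (θ : Θ) (x : X) : ℝ := M.trunc b θ x (M.greedy θ x)

/-- The Feel-Good negative log-likelihood. -/
def Model.loss (M : Model Θ B) (η lam b : ℝ) (θ : Θ) (x : X) (a : A) (r : ℝ) : ℝ :=
  η * (M.f θ x a - r) ^ 2 - lam * min b (M.maxValue θ x)

/-- The excess loss `ΔL`. -/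
def Model.excessLoss (M : Model Θ B) (η lam b : ℝ) (θ : Θ) (x : X) (a : A) (r : ℝ) : ℝ :=
  η * ((M.f θ x a - r) ^ 2 - (B.value x a - r) ^ 2)
    - lam * (min b (M.maxValue θ x) - B.optValue x)

/-- `K` satisfies the decoupling inequality at `x`: for all probability distributions `q`
concentrated on `S`, with induced policy `π_q`, the law of `greedy θ x` for `θ` drawn from `q`. -/
def Model.Decouples (M : Model Θ B) (x : X) (b : ℝ) (S : Set Θ) (K : ℝ≥0) : Prop :=
  ∀ q : Measure Θ, IsProbabilityMeasure q → q Sᶜ = 0 → ∀ μ : ℝ, 0 < μ →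
    ∫ θ, (M.trunc b θ x (M.greedy θ x) - B.value x (M.greedy θ x)) ∂q ≤
      μ * ∫ a, (∫ θ, (M.trunc b θ x a - B.value x a) ^ 2 ∂q) ∂(q.map fun θ => M.greedy θ x)
        + K / (4 * μ)

/-- The decoupling coefficient `dc(x, b, S, B)`: the smallest `K` satisfying the decoupling
inequality, and `∞` if there is none. (A real `K` satisfying the inequality for one `q` is
nonnegative: multiply by `4 * μ` and let `μ` tend to `0`.) -/
def Model.dc (M : Model Θ B) (x : X) (b : ℝ) (S : Set Θ) : ℝ≥0∞ :=
  ⨅ (K : ℝ≥0) (_ : M.Decouples x b S K), (K : ℝ≥0∞)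

/-- The unnormalized density of the restricted posterior with respect to the prior. -/
def Model.weight (M : Model Θ B) (η lam b : ℝ) {t : ℕ} (S : Set Θ) (h : History X A t)
    (θ : Θ) : ℝ :=
  S.indicator
    (fun θ => Real.exp (-∑ i, M.loss η lam b θ (h i).1 (h i).2.1 (h i).2.2)) θ

/-- The restricted posterior given the history `h` of `t` rounds and the new context `x`: it has
density proportional to `exp (-∑ L) 1_{Ω t h x}` with respect to the prior. -/
def Model.posterior (M : Model Θ B) (η lam b : ℝ) (prior : Measure Θ) [SFinite prior] (t : ℕ)
    (Ω : History X A t → X → Set Θ) : Kernel (History X A t × X) Θ :=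
  Kernel.withDensity (Kernel.const _ prior) fun p θ =>
    ENNReal.ofReal (M.weight η lam b (Ω p.1 p.2) p.1 θ
      / ∫ θ', M.weight η lam b (Ω p.1 p.2) p.1 θ' ∂prior)

/-- The restriction set in force after `t` rounds, as a function of the history of these rounds;
no restriction for `t = 0`. (`Ω t h x` is the set used in round `t + 1`.) -/
def activeSet (Ω : (t : ℕ) → History X A t → X → Set Θ) :
    (t : ℕ) → History X A t → Set Θ
  | 0, _ => Set.univ
  | t + 1, h => Ω t (Fin.init h) (h (Fin.last t)).1

/-- The log-partition function of the excess losses under the prior,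
`ln E_θ 1_{Ω_t}(θ) exp (-∑ ΔL)`, for a history of `t` rounds. -/
def Model.logPartition (M : Model Θ B) (η lam b : ℝ) (prior : Measure Θ)
    (Ω : (t : ℕ) → History X A t → X → Set Θ) (t : ℕ) (h : History X A t) : ℝ :=
  Real.log (∫ θ, (activeSet Ω t h).indicator
    (fun θ => Real.exp (-∑ i, M.excessLoss η lam b θ (h i).1 (h i).2.1 (h i).2.2)) θ ∂prior)

/-- `f(θ, x, a) = ⟨w(θ, x), φ(x, a)⟩` and `f_*(x, a) = ⟨w_*(x), φ(x, a)⟩` with features in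
`ℝ ^ K`. -/
def Model.LinearlyEmbeddable (M : Model Θ B) (K : ℕ) : Prop :=
  ∃ (φ : X → A → EuclideanSpace ℝ (Fin K)) (w : Θ → X → EuclideanSpace ℝ (Fin K))
    (wstar : X → EuclideanSpace ℝ (Fin K)),
    (∀ x, Measurable (φ x)) ∧ (∀ x, Measurable fun θ => w θ x) ∧
    ∀ x, ∀ a ∈ B.actions x,
      (∀ θ, M.f θ x a = inner ℝ (w θ x) (φ x a)) ∧ B.value x a = inner ℝ (wstar x) (φ x a)

/-- The random variables of a run: contexts, sampled parameters, and rewards.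
Rounds are numbered from `0`. -/
structure Run (Θ X W : Type*) where
  x : ℕ → W → X
  θ : ℕ → W → Θ
  r : ℕ → W → ℝ

variable {W : Type*}

/-- The action taken in round `t`. -/
def Run.action (R : Run Θ X W) (M : Model Θ B) (t : ℕ) (ω : W) : A :=
  M.greedy (R.θ t ω) (R.x t ω)

/-- The history of the first `t` rounds. -/
def Run.hist (R : Run Θ X W) (M : Model Θ B) (t : ℕ) (ω : W) : History X A t :=
  fun i => (R.x i ω, R.action M i ω, R.r i ω)

variable [MeasurableSpace W]

/-- `R` is a run of `T` rounds of Feel-Good Thompson Sampling with restricted posterior: given the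
past and the current context, the parameter is drawn from the posterior; given the past, the
context and the action, the reward follows the reward law of the bandit. The contexts are chosen
by an arbitrary (adaptive, possibly randomized) adversary. The first condition forces the prior
mass of the restriction set to be almost surely positive, as the posterior as defined above is
the zero measure otherwise. -/
structure Run.IsFeelGoodTS (R : Run Θ X W) (M : Model Θ B) (η lam b : ℝ) (prior : Measure Θ)
    [SFinite prior] (Ω : (t : ℕ) → History X A t → X → Set Θ) (T : ℕ) (P : Measure W) :
    Prop where
  param : ∀ t < T, HasCondDistrib (R.θ t) (fun ω => (R.hist M t ω, R.x t ω))
    (M.posterior η lam b prior t (Ω t)) P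
  reward : ∀ t < T, HasCondDistrib (R.r t) (fun ω => (R.hist M t ω, R.x t ω, R.action M t ω))
    (B.rewardGiven t) P

/-- `E REG_t`. -/
def Run.expRegret (R : Run Θ X W) (M : Model Θ B) (P : Measure W) (t : ℕ) : ℝ :=
  ∫ ω, (B.optValue (R.x t ω) - B.value (R.x t ω) (R.action M t ω)) ∂P

/-- `E FG_t`, the expected Feel-Good term. -/
def Run.expFG (R : Run Θ X W) (M : Model Θ B) (b : ℝ) (P : Measure W) (t : ℕ) : ℝ :=
  ∫ ω, (M.truncMax b (R.θ t ω) (R.x t ω) - B.optValue (R.x t ω)) ∂P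

/-- `E LS_t`, the expected squared error at `(x_t, a_t)` of a parameter drawn from the posterior
independently of `a_t`. -/
def Run.expLS (R : Run Θ X W) (M : Model Θ B) (η lam b : ℝ) (prior : Measure Θ) [SFinite prior]
    (Ω : (t : ℕ) → History X A t → X → Set Θ) (P : Measure W) (t : ℕ) : ℝ :=
  ∫ ω, (∫ θ, (M.trunc b θ (R.x t ω) (R.action M t ω)
      - B.value (R.x t ω) (R.action M t ω)) ^ 2
    ∂(M.posterior η lam b prior t (Ω t) (R.hist M t ω, R.x t ω))) ∂P

/-- The expectation `E ∑ dc(x_t, b, Ω_t, B)` over the first `T` rounds, with values in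
`[0, ∞]`. -/
def Run.expDC (R : Run Θ X W) (M : Model Θ B) (b : ℝ)
    (Ω : (t : ℕ) → History X A t → X → Set Θ) (P : Measure W) (T : ℕ) : ℝ≥0∞ :=
  ∑ t ∈ Finset.range T, ∫⁻ ω, M.dc (R.x t ω) b (Ω t (R.hist M t ω) (R.x t ω)) ∂P

end Model

/-- The expectation with values in `[-∞, ∞]`: that of the positive part minus that of the negative
part. -/
def extExp {W : Type*} [MeasurableSpace W] (P : Measure W) (Y : W → ℝ) : EReal :=
  ((∫⁻ ω, ENNReal.ofReal (Y ω) ∂P : ℝ≥0∞) : EReal)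
    - ((∫⁻ ω, ENNReal.ofReal (-Y ω) ∂P : ℝ≥0∞) : EReal)

end FeelGood

end

/-!
The regret of a round splits as `REG = (f_b(θ_t, x_t) - f_*(x_t, a_t)) - FG`. Given the past and the
context, the parameter `θ_t` has the law of the posterior, so the decoupling inequality at the
posterior bounds the first term by the squared error `LS` and the decoupling coefficient. This is
the first inequality (`Run.IsFeelGoodTS.ofReal_expRegret_le`,
`Model.ofReal_decouplingGap_le_dc`). The decoupling coefficient need not be measurable in the
context; it bounds a measurable function from above, which is all that is used.

For the second inequality, the ratio of successive partition functions is at most the posterior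
expectation `Y_t` of `exp (-ΔL)`, because the restriction sets decrease
(`Model.partitionFn_succ`). Averaging over the sub-Gaussian reward and separating the square loss
from the Feel-Good term by the Cauchy–Schwarz inequality and Hoeffding's lemma, one finds that
`Y_t` has conditional expectation at most `exp G_t`, where
`G_t = λ E FG - 0.25 η E LS + 1.5 λ² (b + 1)²` with expectations under the posterior
(`integral_exp_neg_add_le`, `Model.lintegral_integral_exp_neg_excessLoss_le`). Since
`log Y_t ≤ Y_t exp (-G_t) - 1 + G_t`, the log-partition function is bounded by an integrable function
whose expectation is at most `∑ E G_t`, and this also shows that its expectation is well defined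
(`Run.IsFeelGoodTS.extExp_logPartition_le`).

Both arguments work for any function `u` below the squared error `(f - f_*)²` and below `(b + 1)²` in
place of the squared error of the truncated value function (`Model.IsErrorBound`). This matters for
linearly embeddable bandits, where truncation destroys linearity. There the error `f - f_*` is
instead multiplied by a factor `α(θ, x) ∈ [0, 1]`, chosen such that at the greedy action of `θ` it
becomes the error of the truncated value (`Model.shrunkError`). The shrunk error is a bounded kernel
of rank at most `K` in the parameter and the action, and for such kernels the decoupling inequality
holds with coefficient `K` (`integral_dotProduct_le`), by Young's inequality for the second moment
matrix of the features.
-/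

noncomputable section

namespace FeelGood

/-! ### An exponential moment inequality -/

theorem exp_neg_mul_le {z : ℝ} (hz0 : 0 ≤ z) (hz1 : z ≤ 1) :
    Real.exp (-(7 / 4 * z)) ≤ 1 - z / 2 := by
  have h1 : 0 < 1 + 7 / 4 * z := by positivity
  have h2 : 1 + 7 / 4 * z ≤ Real.exp (7 / 4 * z) := by
    linarith [Real.add_one_le_exp (7 / 4 * z)]
  rw [Real.exp_neg]
  calc (Real.exp (7 / 4 * z))⁻¹ ≤ (1 + 7 / 4 * z)⁻¹ := inv_anti₀ h1 h2
    _ ≤ 1 - z / 2 := by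
      rw [inv_le_iff_one_le_mul₀ h1]
      nlinarith

/-- The exponential moment bound behind one round of the analysis. The two terms of the exponent
are separated by the Cauchy–Schwarz inequality; the quadratic loss `u` is then handled by
a linear bound for the exponential on `[0, 1]`, and the Feel-Good term `g`, whose range has length at most `2 (b + 1)`, by Hoeffding's
lemma. -/
theorem integral_exp_neg_add_le {Θ : Type*} [MeasurableSpace Θ] {p : Measure Θ}
    [IsProbabilityMeasure p] {u g : Θ → ℝ} (hum : Measurable u) (hgm : Measurable g)
    {η b : ℝ} (hη : 0 < η) (hb : 0 ≤ b) (hηb : η ≤ 1 / (b + 1) ^ 2) (lam : ℝ)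
    (hu : ∀ θ, u θ ∈ Set.Icc 0 ((b + 1) ^ 2)) (hg : ∀ θ, g θ ∈ Set.Icc (-(b + 1)) b) :
    ∫ θ, Real.exp (-(7 / 8 * η * u θ) + lam * g θ) ∂p ≤
      Real.exp (lam * ∫ θ, g θ ∂p - 0.25 * η * ∫ θ, u θ ∂p + 1.5 * lam ^ 2 * (b + 1) ^ 2) := by
  have hui : Integrable u p := Integrable.of_mem_Icc _ _ hum.aemeasurable (.of_forall hu)
  have hsub := hasSubgaussianMGF_of_mem_Icc (μ := p) hgm.aemeasurable (.of_forall hg)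
  set m := ∫ θ, g θ ∂p with hm
  set v := ∫ θ, u θ ∂p with hv
  have hηb' : η * (b + 1) ^ 2 ≤ 1 := by
    rwa [le_div_iff₀ (by positivity)] at hηb
  have hz : ∀ θ, η * u θ ∈ Set.Icc (0 : ℝ) 1 := fun θ =>
    ⟨mul_nonneg hη.le (hu θ).1, (mul_le_mul_of_nonneg_left (hu θ).2 hη.le).trans hηb'⟩
  -- second moment of the first factor: `η * u ≤ 1`, so `exp_neg_mul_le` applies
  have hx : ∫ θ, Real.exp (-(7 / 4 * (η * u θ))) ∂p ≤ Real.exp (-(0.5 * η * v)) := by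
    calc ∫ θ, Real.exp (-(7 / 4 * (η * u θ))) ∂p ≤ ∫ θ, (1 - η * u θ / 2) ∂p := by
          refine integral_mono_of_nonneg (.of_forall fun θ => (Real.exp_pos _).le) ?_
            (.of_forall fun θ => exp_neg_mul_le (hz θ).1 (hz θ).2)
          exact (integrable_const _).sub ((hui.const_mul η).div_const 2)
      _ = 1 - η * v / 2 := by
          rw [integral_sub (integrable_const _) ((hui.const_mul η).div_const 2),
            integral_div, integral_const_mul]
          simp [hv]
      _ ≤ Real.exp (-(0.5 * η * v)) := by
          linarith [Real.add_one_le_exp (-(0.5 * η * v))]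
  have hxi : Integrable (fun θ => Real.exp (-(7 / 4 * (η * u θ)))) p :=
    Integrable.of_mem_Icc 0 1 (by fun_prop) (.of_forall fun θ =>
      ⟨(Real.exp_pos _).le, Real.exp_le_one_iff.2 (by linarith [(hz θ).1])⟩)
  -- second moment of the second factor
  have hy : ∫ θ, Real.exp (2 * lam * (g θ - m)) ∂p ≤ Real.exp (2 * lam ^ 2 * (b + 1) ^ 2) := by
    refine (hsub.mgf_le (2 * lam)).trans (Real.exp_le_exp.2 ?_)
    have : ((((‖b - -(b + 1)‖₊ / 2) ^ 2 : ℝ≥0)) : ℝ) = ((2 * b + 1) / 2) ^ 2 := by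
      push_cast
      rw [Real.norm_of_nonneg (by linarith)]
      ring
    rw [this]
    have h1 : (2 * b + 1) ^ 2 ≤ (2 * (b + 1)) ^ 2 := by gcongr; linarith
    nlinarith [mul_le_mul_of_nonneg_left h1 (sq_nonneg lam)]
  have hyi : Integrable (fun θ => Real.exp (2 * lam * (g θ - m))) p :=
    hsub.integrable_exp_mul (2 * lam)
  set α := -(0.25 * η * v) with hα
  set β := lam ^ 2 * (b + 1) ^ 2 with hβ
  -- the arithmetic-geometric mean inequality for the two factors, normalized in `L²`
  have hpt : ∀ θ, Real.exp (-(7 / 8 * η * u θ) + lam * g θ) ≤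
      Real.exp (α + β + lam * m) * ((Real.exp (-(2 * α)) * Real.exp (-(7 / 4 * (η * u θ)))
        + Real.exp (-(2 * β)) * Real.exp (2 * lam * (g θ - m))) / 2) := by
    intro θ
    set s := Real.exp (-α - 7 / 8 * η * u θ)
    set w := Real.exp (-β + lam * (g θ - m))
    have e1 : Real.exp (-(2 * α)) * Real.exp (-(7 / 4 * (η * u θ))) = s ^ 2 := by
      rw [← Real.exp_add, ← Real.exp_nat_mul]; congr 1; push_cast; ring
    have e2 : Real.exp (-(2 * β)) * Real.exp (2 * lam * (g θ - m)) = w ^ 2 := by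
      rw [← Real.exp_add, ← Real.exp_nat_mul]; congr 1; push_cast; ring
    have e3 : Real.exp (-(7 / 8 * η * u θ) + lam * g θ) =
        Real.exp (α + β + lam * m) * (s * w) := by
      rw [← Real.exp_add, ← Real.exp_add]; congr 1; ring
    rw [e1, e2, e3]
    gcongr
    nlinarith [sq_nonneg (s - w)]
  calc ∫ θ, Real.exp (-(7 / 8 * η * u θ) + lam * g θ) ∂p
      ≤ ∫ θ, Real.exp (α + β + lam * m) * ((Real.exp (-(2 * α)) * Real.exp (-(7 / 4 * (η * u θ)))
        + Real.exp (-(2 * β)) * Real.exp (2 * lam * (g θ - m))) / 2) ∂p :=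
        integral_mono_of_nonneg (.of_forall fun θ => (Real.exp_pos _).le)
          ((((hxi.const_mul _).add (hyi.const_mul _)).div_const 2).const_mul _)
          (.of_forall hpt)
    _ = Real.exp (α + β + lam * m) *
        ((Real.exp (-(2 * α)) * ∫ θ, Real.exp (-(7 / 4 * (η * u θ))) ∂p
        + Real.exp (-(2 * β)) * ∫ θ, Real.exp (2 * lam * (g θ - m)) ∂p) / 2) := by
        rw [integral_const_mul, integral_div,
          integral_add (hxi.const_mul _) (hyi.const_mul _), integral_const_mul,
          integral_const_mul]
    _ ≤ Real.exp (α + β + lam * m) * ((1 + 1) / 2) := by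
        gcongr
        · calc _ ≤ Real.exp (-(2 * α)) * Real.exp (-(0.5 * η * v)) := by gcongr
            _ = 1 := by rw [← Real.exp_add, hα]; ring_nf; simp
        · calc _ ≤ Real.exp (-(2 * β)) * Real.exp (2 * lam ^ 2 * (b + 1) ^ 2) := by gcongr
            _ = 1 := by rw [← Real.exp_add, hβ]; ring_nf; simp
    _ ≤ _ := by
        norm_num only
        rw [mul_one]
        refine Real.exp_le_exp.2 ?_
        have : 0 ≤ β := by positivity
        linarith

/-! ### Decoupling for finite-rank kernels -/

open Matrix in
/-- Young's inequality for the scalar product of a positive definite matrix and that of its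
inverse. -/
theorem dotProduct_le_of_posDef {n : Type*} [Fintype n] [DecidableEq n] {S : Matrix n n ℝ}
    (hS : S.PosDef) (v w : n → ℝ) {μ : ℝ} (hμ : 0 < μ) :
    v ⬝ᵥ w ≤ μ * (v ⬝ᵥ (S *ᵥ v)) + (1 / (4 * μ)) * (w ⬝ᵥ (S⁻¹ *ᵥ w)) := by
  set y := S⁻¹ *ᵥ w with hy
  have hSy : S *ᵥ y = w := by
    rw [hy, Matrix.mulVec_mulVec,
      Matrix.mul_nonsing_inv _ ((Matrix.isUnit_iff_isUnit_det _).1 hS.isUnit),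
      Matrix.one_mulVec]
  have hsymm : y ⬝ᵥ (S *ᵥ v) = v ⬝ᵥ w := by
    have hT : Sᵀ = S := by simpa using hS.isHermitian.eq
    rw [Matrix.dotProduct_mulVec, ← Matrix.mulVec_transpose, hT, hSy, dotProduct_comm]
  have h := hS.posSemidef.dotProduct_mulVec_nonneg (μ • v - (1 / 2 : ℝ) • y)
  simp only [star_trivial, Matrix.mulVec_sub, Matrix.mulVec_smul, sub_dotProduct, dotProduct_sub,
    smul_dotProduct, dotProduct_smul, hSy, hsymm, smul_eq_mul] at h
  rw [dotProduct_comm y w] at h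
  have : v ⬝ᵥ w ≤ (μ * (μ * (v ⬝ᵥ (S *ᵥ v))) + 1 / 4 * (w ⬝ᵥ y)) / μ := by
    rw [le_div_iff₀ hμ]; linarith
  refine this.trans_eq ?_
  field_simp


open Matrix in
/-- The decoupling inequality for a bounded kernel `⟨v(θ), w(θ')⟩`, up to an error `ε`: apply Young's
inequality to the matrix `E w wᵀ + ε`; the expectation of the second term is a trace which is at
most the dimension. -/
theorem integral_dotProduct_le_add {Θ ι : Type*} [MeasurableSpace Θ] [Fintype ι]
    {q : Measure Θ} [IsProbabilityMeasure q] {v w : Θ → ι → ℝ} (hv : Measurable v)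
    (hw : Measurable w) {N : ℝ} (hvN : ∀ θ, ‖v θ‖ ≤ N) (hwN : ∀ θ, ‖w θ‖ ≤ N) {μ ε : ℝ}
    (hμ : 0 < μ) (hε : 0 < ε) :
    ∫ θ, v θ ⬝ᵥ w θ ∂q ≤ μ * (∫ θ, ∫ θ', (v θ ⬝ᵥ w θ') ^ 2 ∂q ∂q + ε * ∫ θ, v θ ⬝ᵥ v θ ∂q)
      + Fintype.card ι / (4 * μ) := by
  classical
  have hvi : ∀ i, Measurable fun θ => v θ i := fun i => (measurable_pi_apply i).comp hv
  have hwi : ∀ i, Measurable fun θ => w θ i := fun i => (measurable_pi_apply i).comp hw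
  have hvb : ∀ θ i, |v θ i| ≤ N := fun θ i => (norm_le_pi_norm (v θ) i).trans (hvN θ)
  have hwb : ∀ θ i, |w θ i| ≤ N := fun θ i => (norm_le_pi_norm (w θ) i).trans (hwN θ)
  have hww : ∀ i j, Integrable (fun θ => w θ i * w θ j) q := fun i j =>
    Integrable.of_bound ((hwi i).mul (hwi j)).aestronglyMeasurable (N * N) (.of_forall fun θ => by
      rw [norm_mul]
      exact mul_le_mul (hwb θ i) (hwb θ j) (abs_nonneg _) ((abs_nonneg _).trans (hwb θ i)))
  have hvv : ∀ i j, Integrable (fun θ => v θ i * v θ j) q := fun i j =>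
    Integrable.of_bound ((hvi i).mul (hvi j)).aestronglyMeasurable (N * N) (.of_forall fun θ => by
      rw [norm_mul]
      exact mul_le_mul (hvb θ i) (hvb θ j) (abs_nonneg _) ((abs_nonneg _).trans (hvb θ i)))
  have hvw : ∀ i j, Integrable (fun θ => v θ i * w θ j) q := fun i j =>
    Integrable.of_bound ((hvi i).mul (hwi j)).aestronglyMeasurable (N * N) (.of_forall fun θ => by
      rw [norm_mul]
      exact mul_le_mul (hvb θ i) (hwb θ j) (abs_nonneg _) ((abs_nonneg _).trans (hvb θ i)))
  -- the second moment matrix of `w` and its quadratic form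
  set G : Matrix ι ι ℝ := Matrix.of fun i j => ∫ θ, w θ i * w θ j ∂q with hG
  have hquad : ∀ x : ι → ℝ, x ⬝ᵥ (G *ᵥ x) = ∫ θ, (x ⬝ᵥ w θ) ^ 2 ∂q := by
    intro x
    have : ∀ θ, (x ⬝ᵥ w θ) ^ 2 = ∑ i, ∑ j, x i * x j * (w θ i * w θ j) := by
      intro θ
      rw [sq, dotProduct, Finset.sum_mul_sum]
      exact Finset.sum_congr rfl fun i _ => Finset.sum_congr rfl fun j _ => by ring
    simp_rw [this]
    rw [integral_finsetSum _ fun i _ =>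
      integrable_finsetSum _ fun j _ => (hww i j).const_mul _]
    refine Finset.sum_congr rfl fun i _ => ?_
    rw [integral_finsetSum _ fun j _ => (hww i j).const_mul _, Matrix.mulVec, dotProduct,
      Finset.mul_sum]
    refine Finset.sum_congr rfl fun j _ => ?_
    rw [integral_const_mul]
    simp only [hG, Matrix.of_apply]
    ring
  have hGsymm : G.IsHermitian := by
    ext i j
    simp [hG, mul_comm]
  have hGpsd : G.PosSemidef := Matrix.PosSemidef.of_dotProduct_mulVec_nonneg hGsymm fun x => by
    rw [star_trivial, hquad]
    exact integral_nonneg fun θ => sq_nonneg _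
  set S : Matrix ι ι ℝ := G + ε • (1 : Matrix ι ι ℝ) with hS
  have hSpd : S.PosDef := Matrix.PosDef.posSemidef_add hGpsd (Matrix.PosDef.one.smul hε)
  have hSquad : ∀ x : ι → ℝ, x ⬝ᵥ (S *ᵥ x) = ∫ θ, (x ⬝ᵥ w θ) ^ 2 ∂q + ε * (x ⬝ᵥ x) := by
    intro x
    rw [hS, Matrix.add_mulVec, dotProduct_add, hquad, Matrix.smul_mulVec, Matrix.one_mulVec,
      dotProduct_smul, smul_eq_mul]
  -- integrability of the terms of Young's inequality
  have hint : ∀ (A : Matrix ι ι ℝ) (y : Θ → ι → ℝ),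
      (∀ i j, Integrable (fun θ => y θ i * y θ j) q) →
      Integrable (fun θ => y θ ⬝ᵥ (A *ᵥ y θ)) q ∧
      ∫ θ, y θ ⬝ᵥ (A *ᵥ y θ) ∂q = ∑ i, ∑ j, A i j * ∫ θ, y θ i * y θ j ∂q := by
    intro A y hy
    have : ∀ θ, y θ ⬝ᵥ (A *ᵥ y θ) = ∑ i, ∑ j, A i j * (y θ i * y θ j) := by
      intro θ
      refine Finset.sum_congr rfl fun i _ => ?_
      rw [Matrix.mulVec, dotProduct, Finset.mul_sum]
      exact Finset.sum_congr rfl fun j _ => by ring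
    have hi : ∀ i, Integrable (fun θ => ∑ j, A i j * (y θ i * y θ j)) q := fun i =>
      integrable_finsetSum _ fun j _ => (hy i j).const_mul _
    simp_rw [this]
    refine ⟨integrable_finsetSum _ fun i _ => hi i, ?_⟩
    refine (integral_finsetSum _ fun i _ => hi i).trans (Finset.sum_congr rfl fun i _ => ?_)
    rw [integral_finsetSum _ fun j _ => (hy i j).const_mul _]
    exact Finset.sum_congr rfl fun j _ => integral_const_mul _ _
  have hvvi : Integrable (fun θ => v θ ⬝ᵥ v θ) q := integrable_finsetSum _ fun i _ => hvv i i
  have hvwi : Integrable (fun θ => v θ ⬝ᵥ w θ) q := integrable_finsetSum _ fun i _ => hvw i i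
  have hvS : ∫ θ, v θ ⬝ᵥ (S *ᵥ v θ) ∂q =
      ∫ θ, ∫ θ', (v θ ⬝ᵥ w θ') ^ 2 ∂q ∂q + ε * ∫ θ, v θ ⬝ᵥ v θ ∂q := by
    have h1 : Integrable (fun θ => v θ ⬝ᵥ (G *ᵥ v θ)) q := (hint G v hvv).1
    simp_rw [hquad] at h1
    simp_rw [hSquad]
    rw [integral_add h1 (hvvi.const_mul _), integral_const_mul]
  have hwS : ∫ θ, w θ ⬝ᵥ (S⁻¹ *ᵥ w θ) ∂q ≤ Fintype.card ι := by
    have h1 : ∫ θ, w θ ⬝ᵥ (S⁻¹ *ᵥ w θ) ∂q = (S⁻¹ * G).trace := by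
      rw [(hint S⁻¹ w hww).2, Matrix.trace]
      refine Finset.sum_congr rfl fun i _ => ?_
      rw [Matrix.diag_apply, Matrix.mul_apply]
      refine Finset.sum_congr rfl fun j _ => ?_
      rw [← hGsymm.apply j i]
      simp [hG]
    have h2 : S⁻¹ * G = 1 - ε • S⁻¹ := by
      have : G = S - ε • (1 : Matrix ι ι ℝ) := by rw [hS, add_sub_cancel_right]
      rw [this, Matrix.mul_sub,
        Matrix.nonsing_inv_mul _ ((Matrix.isUnit_iff_isUnit_det _).1 hSpd.isUnit),
        Matrix.mul_smul, Matrix.mul_one]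
    rw [h1, h2, Matrix.trace_sub, Matrix.trace_one, Matrix.trace_smul, smul_eq_mul]
    have := hSpd.inv.posSemidef.trace_nonneg
    nlinarith
  calc ∫ θ, v θ ⬝ᵥ w θ ∂q
      ≤ ∫ θ, (μ * (v θ ⬝ᵥ (S *ᵥ v θ)) + (1 / (4 * μ)) * (w θ ⬝ᵥ (S⁻¹ *ᵥ w θ))) ∂q :=
        integral_mono hvwi (((hint S v hvv).1.const_mul _).add ((hint S⁻¹ w hww).1.const_mul _))
          fun θ => dotProduct_le_of_posDef hSpd _ _ hμ
    _ = μ * (∫ θ, ∫ θ', (v θ ⬝ᵥ w θ') ^ 2 ∂q ∂q + ε * ∫ θ, v θ ⬝ᵥ v θ ∂q)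
          + (1 / (4 * μ)) * ∫ θ, w θ ⬝ᵥ (S⁻¹ *ᵥ w θ) ∂q := by
        rw [integral_add ((hint S v hvv).1.const_mul _) ((hint S⁻¹ w hww).1.const_mul _),
          integral_const_mul, integral_const_mul, hvS]
    _ ≤ _ := by
        rw [div_eq_mul_one_div (Fintype.card ι : ℝ), mul_comm (Fintype.card ι : ℝ)]
        gcongr

open Matrix Filter Topology in
/-- The decoupling inequality for a kernel of finite rank: the diagonal of `⟨v(θ), w(θ')⟩` is
controlled by its second moment under independent parameters. Only the kernel itself is assumed
to be bounded, so the vectors are truncated first. -/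
theorem integral_dotProduct_le {Θ ι : Type*} [MeasurableSpace Θ] [Fintype ι]
    {q : Measure Θ} [IsProbabilityMeasure q] {v w : Θ → ι → ℝ} (hv : Measurable v)
    (hw : Measurable w) {S : Set Θ} (hS : q Sᶜ = 0) {C : ℝ}
    (hC : ∀ θ ∈ S, ∀ θ' ∈ S, |v θ ⬝ᵥ w θ'| ≤ C) {μ : ℝ} (hμ : 0 < μ) :
    ∫ θ, v θ ⬝ᵥ w θ ∂q ≤ μ * ∫ θ, ∫ θ', (v θ ⬝ᵥ w θ') ^ 2 ∂q ∂q
      + Fintype.card ι / (4 * μ) := by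
  have hSae : ∀ᵐ θ ∂q, θ ∈ S := hS
  have hdot : Measurable fun z : (ι → ℝ) × (ι → ℝ) => z.1 ⬝ᵥ z.2 := by
    unfold dotProduct; fun_prop
  set tr : ℕ → (ι → ℝ) → ι → ℝ := fun n x => if ‖x‖ ≤ n then x else 0 with htr
  have htrm : ∀ n, Measurable (tr n) := fun n =>
    Measurable.ite (measurableSet_le measurable_norm measurable_const) measurable_id
      measurable_const
  have htrN : ∀ n x, ‖tr n x‖ ≤ n := by
    intro n x
    simp only [htr]
    split_ifs with h
    · exact h
    · simp
  have htrdot : ∀ n x y, |tr n x ⬝ᵥ tr n y| ≤ |x ⬝ᵥ y| := by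
    intro n x y
    simp only [htr]
    split_ifs <;> simp
  have hinner : ∀ θ ∈ S, Integrable (fun θ' => (v θ ⬝ᵥ w θ') ^ 2) q := fun θ hθ =>
    Integrable.of_bound ((hdot.comp (measurable_const.prodMk hw)).pow_const 2).aestronglyMeasurable
      (C ^ 2) (by
        filter_upwards [hSae] with θ' hθ'
        rw [norm_pow]
        exact pow_le_pow_left₀ (norm_nonneg _) (hC θ hθ θ' hθ') 2)
  have hmeas2 : StronglyMeasurable fun θ => ∫ θ', (v θ ⬝ᵥ w θ') ^ 2 ∂q := by
    refine StronglyMeasurable.integral_prod_right (f := fun θ θ' => (v θ ⬝ᵥ w θ') ^ 2) ?_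
    exact ((hdot.comp ((hv.comp measurable_fst).prodMk (hw.comp measurable_snd))).pow_const
      2).stronglyMeasurable
  have houter : Integrable (fun θ => ∫ θ', (v θ ⬝ᵥ w θ') ^ 2 ∂q) q := by
    refine Integrable.of_bound hmeas2.aestronglyMeasurable (C ^ 2) ?_
    filter_upwards [hSae] with θ hθ
    rw [Real.norm_of_nonneg (integral_nonneg fun _ => sq_nonneg _)]
    calc ∫ θ', (v θ ⬝ᵥ w θ') ^ 2 ∂q ≤ ∫ _, C ^ 2 ∂q := by
          refine integral_mono_ae (hinner θ hθ) (integrable_const _) ?_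
          filter_upwards [hSae] with θ' hθ'
          exact sq_le_sq' (abs_le.1 (hC θ hθ θ' hθ')).1 (abs_le.1 (hC θ hθ θ' hθ')).2
      _ = C ^ 2 := by simp
  -- the inequality for the truncated vectors, where the error `ε` can be removed
  have key : ∀ n : ℕ, ∫ θ, tr n (v θ) ⬝ᵥ tr n (w θ) ∂q ≤
      μ * ∫ θ, ∫ θ', (v θ ⬝ᵥ w θ') ^ 2 ∂q ∂q + Fintype.card ι / (4 * μ) := by
    intro n
    set I := ∫ θ, ∫ θ', (v θ ⬝ᵥ w θ') ^ 2 ∂q ∂q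
    set V := ∫ θ, tr n (v θ) ⬝ᵥ tr n (v θ) ∂q
    have h1 : ∀ ε : ℝ, 0 < ε → ∫ θ, tr n (v θ) ⬝ᵥ tr n (w θ) ∂q ≤
        μ * (I + ε * V) + Fintype.card ι / (4 * μ) := by
      intro ε hε
      refine (integral_dotProduct_le_add ((htrm n).comp hv) ((htrm n).comp hw)
        (fun θ => htrN n _) (fun θ => htrN n _) hμ hε).trans ?_
      simp only [Function.comp_apply]
      gcongr
      refine integral_mono_of_nonneg (.of_forall fun θ => integral_nonneg fun _ => sq_nonneg _)
        houter ?_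
      filter_upwards [hSae] with θ hθ
      exact integral_mono_of_nonneg (.of_forall fun _ => sq_nonneg _) (hinner θ hθ)
        (.of_forall fun θ' => sq_le_sq.2 (htrdot n _ _))
    have h2 : Tendsto (fun ε : ℝ => μ * (I + ε * V) + Fintype.card ι / (4 * μ)) (𝓝[>] 0)
        (𝓝 (μ * (I + 0 * V) + Fintype.card ι / (4 * μ))) := by
      refine Tendsto.mono_left ?_ nhdsWithin_le_nhds
      exact Continuous.tendsto (by fun_prop) 0
    have h3 := ge_of_tendsto h2 (eventually_nhdsWithin_of_forall fun ε hε => h1 ε hε)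
    simpa using h3
  refine le_of_tendsto' (tendsto_integral_of_dominated_convergence (fun _ => C) (fun n => ?_)
    (integrable_const C) (fun n => ?_) ?_) key
  · exact (hdot.comp (((htrm n).comp hv).prodMk ((htrm n).comp hw))).aestronglyMeasurable
  · filter_upwards [hSae] with θ hθ
    exact (htrdot n _ _).trans (hC θ hθ θ hθ)
  · refine .of_forall fun θ => tendsto_const_nhds.congr' ?_
    obtain ⟨n, hn⟩ := exists_nat_ge (max ‖v θ‖ ‖w θ‖)
    filter_upwards [eventually_ge_atTop n] with k hk
    have hk' : (n : ℝ) ≤ k := by exact_mod_cast hk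
    have h1 : ‖v θ‖ ≤ k := ((le_max_left _ _).trans hn).trans hk'
    have h2 : ‖w θ‖ ≤ k := ((le_max_right _ _).trans hn).trans hk'
    simp only [htr, if_pos h1, if_pos h2]

/-! ### One round: the reward and the Feel-Good likelihood -/

section Round

variable {Θ X A : Type*} [MeasurableSpace Θ] [MeasurableSpace X] [MeasurableSpace A]
  {B : Bandit X A}

theorem Bandit.measurable_value (B : Bandit X A) :
    Measurable fun p : X × A => B.value p.1 p.2 := by
  have : StronglyMeasurable fun p : X × A => ∫ r, r ∂(B.reward p) :=
    StronglyMeasurable.integral_kernel_prod_right' (κ := B.reward)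
      (f := fun q : (X × A) × ℝ => q.2) measurable_snd.stronglyMeasurable
  exact this.measurable

theorem Bandit.SubGaussianRewards.bddAbove (hB : B.SubGaussianRewards) (x : X) :
    BddAbove (Set.range fun a : B.actions x => B.value x a) :=
  ⟨1, by rintro _ ⟨a, rfl⟩; exact (hB x a a.2).2.2⟩

theorem Bandit.SubGaussianRewards.value_le_optValue (hB : B.SubGaussianRewards) {x : X} {a : A}
    (ha : a ∈ B.actions x) : B.value x a ≤ B.optValue x :=
  le_ciSup (hB.bddAbove x) ⟨a, ha⟩

theorem Bandit.SubGaussianRewards.optValue_mem (hB : B.SubGaussianRewards) {x : X} {a : A}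
    (ha : a ∈ B.actions x) : B.optValue x ∈ Set.Icc (0 : ℝ) 1 := by
  have : Nonempty (B.actions x) := ⟨⟨a, ha⟩⟩
  exact ⟨(hB x a ha).2.1.trans (hB.value_le_optValue ha), ciSup_le fun a' => (hB x a' a'.2).2.2⟩

theorem Model.measurable_maxValue (M : Model Θ B) :
    Measurable fun p : Θ × X => M.maxValue p.1 p.2 :=
  M.measurable_f.comp (measurable_fst.prodMk (measurable_snd.prodMk M.measurable_greedy))

theorem Model.measurable_trunc (M : Model Θ B) (b : ℝ) :
    Measurable fun p : Θ × X × A => M.trunc b p.1 p.2.1 p.2.2 :=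
  measurable_const.max (measurable_const.min M.measurable_f)

theorem Model.measurable_truncMax (M : Model Θ B) (b : ℝ) :
    Measurable fun p : Θ × X => M.truncMax b p.1 p.2 :=
  (M.measurable_trunc b).comp
    (measurable_fst.prodMk (measurable_snd.prodMk M.measurable_greedy))

theorem Model.trunc_mem (M : Model Θ B) {b : ℝ} (hb : 0 ≤ b) (θ : Θ) (x : X) (a : A) :
    M.trunc b θ x a ∈ Set.Icc (-b) b :=
  ⟨le_max_left _ _, max_le (by linarith) (min_le_left _ _)⟩

theorem Model.truncMax_sub_optValue_mem (M : Model Θ B) (hB : B.SubGaussianRewards) {b : ℝ}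
    (hb : 0 ≤ b) (θ : Θ) (x : X) :
    M.truncMax b θ x - B.optValue x ∈ Set.Icc (-(b + 1)) b := by
  have h1 := hB.optValue_mem (M.greedy_mem θ x)
  have h2 : M.truncMax b θ x ∈ Set.Icc (-b) b := M.trunc_mem hb θ x (M.greedy θ x)
  constructor <;> linarith [h1.1, h1.2, h2.1, h2.2]

theorem Model.trunc_sub_value_sq_mem (M : Model Θ B) (hB : B.SubGaussianRewards) {b : ℝ}
    (hb : 0 ≤ b) (θ : Θ) {x : X} {a : A} (ha : a ∈ B.actions x) :
    (M.trunc b θ x a - B.value x a) ^ 2 ∈ Set.Icc 0 ((b + 1) ^ 2) := by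
  have h1 := (hB x a ha).2
  have h2 := M.trunc_mem hb θ x a
  exact ⟨sq_nonneg _, sq_le_sq' (by linarith [h1.1, h1.2, h2.1, h2.2])
    (by linarith [h1.1, h1.2, h2.1, h2.2])⟩

/-- Truncation is a projection onto an interval that contains the true value, so it does not
increase the error. -/
theorem Model.trunc_sub_value_sq_le (M : Model Θ B) (hB : B.SubGaussianRewards) {b : ℝ}
    (hb : 1 ≤ b) (θ : Θ) {x : X} {a : A} (ha : a ∈ B.actions x) :
    (M.trunc b θ x a - B.value x a) ^ 2 ≤ (M.f θ x a - B.value x a) ^ 2 := by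
  have h1 := (hB x a ha).2.1
  have h2 := (hB x a ha).2.2
  rw [Model.trunc]
  rcases max_cases (-b) (min b (M.f θ x a)) with h | h <;>
    rcases min_cases b (M.f θ x a) with h' | h' <;>
    rw [h.1] <;> try rw [h'.1]
  all_goals
    first
    | exact le_rfl
    | nlinarith

theorem Model.measurable_loss (M : Model Θ B) (η lam b : ℝ) :
    Measurable fun p : Θ × X × A × ℝ => M.loss η lam b p.1 p.2.1 p.2.2.1 p.2.2.2 := by
  have h1 : Measurable fun p : Θ × X × A × ℝ => M.f p.1 p.2.1 p.2.2.1 :=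
    M.measurable_f.comp (f := fun p : Θ × X × A × ℝ => (p.1, p.2.1, p.2.2.1)) (by fun_prop)
  have h2 : Measurable fun p : Θ × X × A × ℝ => M.maxValue p.1 p.2.1 :=
    M.measurable_maxValue.comp (f := fun p : Θ × X × A × ℝ => (p.1, p.2.1)) (by fun_prop)
  unfold Model.loss
  fun_prop

/-- The terms of the excess loss that do not depend on the parameter. -/
theorem Model.excessLoss_eq (M : Model Θ B) (η lam b : ℝ) (θ : Θ) (x : X) (a : A) (r : ℝ) :
    M.excessLoss η lam b θ x a r =
      M.loss η lam b θ x a r + (lam * B.optValue x - η * (B.value x a - r) ^ 2) := by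
  unfold Model.excessLoss Model.loss
  ring

theorem Model.measurable_excessLoss (M : Model Θ B) (hopt : Measurable B.optValue) (η lam b : ℝ) :
    Measurable fun p : Θ × X × A × ℝ => M.excessLoss η lam b p.1 p.2.1 p.2.2.1 p.2.2.2 := by
  have h1 : Measurable fun p : Θ × X × A × ℝ => B.value p.2.1 p.2.2.1 :=
    B.measurable_value.comp (f := fun p : Θ × X × A × ℝ => (p.2.1, p.2.2.1)) (by fun_prop)
  have h2 : Measurable fun p : Θ × X × A × ℝ => B.optValue p.2.1 :=
    hopt.comp (f := fun p : Θ × X × A × ℝ => p.2.1) (by fun_prop)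
  have h3 := M.measurable_loss η lam b
  simp_rw [M.excessLoss_eq]
  fun_prop

theorem Model.neg_loss_le (M : Model Θ B) {η lam : ℝ} (hη : 0 < η) (hlam : 0 < lam) (b : ℝ)
    (θ : Θ) (x : X) (a : A) (r : ℝ) : -M.loss η lam b θ x a r ≤ lam * b := by
  have h1 : lam * min b (M.maxValue θ x) ≤ lam * b :=
    mul_le_mul_of_nonneg_left (min_le_left _ _) hlam.le
  have h2 : 0 ≤ η * (M.f θ x a - r) ^ 2 := by positivity
  unfold Model.loss
  linarith

theorem Model.integrable_exp_neg_excessLoss (M : Model Θ B) {η lam : ℝ} (hη : 0 < η)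
    (hlam : 0 < lam) (b : ℝ) (x : X) (a : A) (r : ℝ) (p : Measure Θ) [IsFiniteMeasure p] :
    Integrable (fun θ => Real.exp (-M.excessLoss η lam b θ x a r)) p := by
  have hm : Measurable fun θ => M.loss η lam b θ x a r :=
    (M.measurable_loss η lam b).comp (f := fun θ : Θ => (θ, x, a, r)) (by fun_prop)
  simp_rw [M.excessLoss_eq]
  refine Integrable.of_bound (by fun_prop)
    (Real.exp (lam * b - (lam * B.optValue x - η * (B.value x a - r) ^ 2)))
    (.of_forall fun θ => ?_)
  rw [Real.norm_of_nonneg (Real.exp_pos _).le]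
  refine Real.exp_le_exp.2 ?_
  linarith [M.neg_loss_le hη hlam b θ x a r]

/-- Averaging over a sub-Gaussian reward turns the excess square loss into the squared error. The
variance proxy `1 / 4` leaves the factor `η - η ^ 2 / 2`, which is at least `7 / 8 * η`. -/
theorem Bandit.SubGaussianRewards.lintegral_exp_sq_loss_le (hB : B.SubGaussianRewards) {x : X}
    {a : A} (ha : a ∈ B.actions x) {η : ℝ} (hη : 0 < η) (hη4 : η ≤ 1 / 4) (y : ℝ) :
    ∫⁻ r, ENNReal.ofReal (Real.exp (-(η * ((y - r) ^ 2 - (B.value x a - r) ^ 2))))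
      ∂(B.reward (x, a)) ≤
    ENNReal.ofReal (Real.exp (-(7 / 8 * η * (y - B.value x a) ^ 2))) := by
  set d := y - B.value x a with hd
  have hsub := (hB x a ha).1
  have hi := hsub.integrable_exp_mul (2 * η * d)
  have hmgf : ∫ r, Real.exp (2 * η * d * (r - B.value x a)) ∂(B.reward (x, a)) ≤ _ :=
    hsub.mgf_le (2 * η * d)
  have heq : ∀ r, Real.exp (-(η * ((y - r) ^ 2 - (B.value x a - r) ^ 2))) =
      Real.exp (-(η * d ^ 2)) * Real.exp (2 * η * d * (r - B.value x a)) := by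
    intro r
    rw [← Real.exp_add, hd]
    congr 1
    ring
  simp_rw [heq]
  rw [← ofReal_integral_eq_lintegral_ofReal (hi.const_mul _)
    (.of_forall fun r => (mul_pos (Real.exp_pos _) (Real.exp_pos _)).le), integral_const_mul]
  refine ENNReal.ofReal_le_ofReal ?_
  calc _ ≤ Real.exp (-(η * d ^ 2)) * _ := mul_le_mul_of_nonneg_left hmgf (Real.exp_pos _).le
    _ ≤ _ := by
      rw [← Real.exp_add]
      refine Real.exp_le_exp.2 ?_
      push_cast
      have : η * (η * d ^ 2) ≤ 1 / 4 * (η * d ^ 2) := by gcongr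
      nlinarith

theorem ofReal_integral_le_lintegral {α : Type*} [MeasurableSpace α] {m : Measure α} {f : α → ℝ}
    (hf : ∀ y, 0 ≤ f y) : ENNReal.ofReal (∫ y, f y ∂m) ≤ ∫⁻ y, ENNReal.ofReal (f y) ∂m := by
  by_cases h : Integrable f m
  · exact (ofReal_integral_eq_lintegral_ofReal h (.of_forall hf)).le
  · simp [integral_undef h]

/-- One round of the analysis: for parameters drawn from `p`, the expected exponential of the
negative excess loss is small, with the Feel-Good term and the square loss in the exponent. The
square loss may be replaced by any smaller bounded function `u`. -/
theorem Model.lintegral_integral_exp_neg_excessLoss_le (M : Model Θ B)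
    (hopt : Measurable B.optValue) (hB : B.SubGaussianRewards) {η lam b : ℝ} (hb : 1 ≤ b)
    (hη : 0 < η) (hηb : η ≤ 1 / (b + 1) ^ 2) (hlam : 0 < lam) {x : X} {a : A}
    (ha : a ∈ B.actions x) (p : Measure Θ) [IsProbabilityMeasure p] {u : Θ → ℝ}
    (hum : Measurable u) (hu : ∀ θ, u θ ∈ Set.Icc 0 ((b + 1) ^ 2))
    (hule : ∀ θ, u θ ≤ (M.f θ x a - B.value x a) ^ 2) :
    ∫⁻ r, ENNReal.ofReal (∫ θ, Real.exp (-M.excessLoss η lam b θ x a r) ∂p) ∂(B.reward (x, a)) ≤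
      ENNReal.ofReal (Real.exp (lam * ∫ θ, (M.truncMax b θ x - B.optValue x) ∂p
        - 0.25 * η * ∫ θ, u θ ∂p + 1.5 * lam ^ 2 * (b + 1) ^ 2)) := by
  have hη4 : η ≤ 1 / 4 := hηb.trans (by
    rw [div_le_div_iff₀ (by positivity) (by norm_num)]; nlinarith)
  have hgm : Measurable fun θ => M.truncMax b θ x - B.optValue x :=
    ((M.measurable_truncMax b).comp (f := fun θ : Θ => (θ, x)) (by fun_prop)).sub_const _
  have hg := fun θ => M.truncMax_sub_optValue_mem hB (by linarith : 0 ≤ b) θ x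
  have hm : Measurable fun q : ℝ × Θ => M.excessLoss η lam b q.2 x a q.1 :=
    (M.measurable_excessLoss hopt η lam b).comp (f := fun q : ℝ × Θ => (q.2, x, a, q.1))
      (by fun_prop)
  calc _ ≤ ∫⁻ r, ∫⁻ θ, ENNReal.ofReal (Real.exp (-M.excessLoss η lam b θ x a r)) ∂p
        ∂(B.reward (x, a)) :=
        lintegral_mono fun r => ofReal_integral_le_lintegral fun θ => (Real.exp_pos _).le
    _ = ∫⁻ θ, ∫⁻ r, ENNReal.ofReal (Real.exp (-M.excessLoss η lam b θ x a r))
        ∂(B.reward (x, a)) ∂p :=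
        lintegral_lintegral_swap hm.neg.exp.ennreal_ofReal.aemeasurable
    _ ≤ ∫⁻ θ, ENNReal.ofReal (Real.exp (-(7 / 8 * η * u θ)
        + lam * (M.truncMax b θ x - B.optValue x))) ∂p := by
        refine lintegral_mono fun θ => ?_
        set g := M.truncMax b θ x - B.optValue x
        have h1 : ∀ r, ENNReal.ofReal (Real.exp (-M.excessLoss η lam b θ x a r)) ≤
            ENNReal.ofReal (Real.exp (lam * g)) * ENNReal.ofReal
              (Real.exp (-(η * ((M.f θ x a - r) ^ 2 - (B.value x a - r) ^ 2)))) := by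
          intro r
          rw [← ENNReal.ofReal_mul (Real.exp_pos _).le, ← Real.exp_add]
          refine ENNReal.ofReal_le_ofReal (Real.exp_le_exp.2 ?_)
          have h2 : lam * (min b (M.maxValue θ x) - B.optValue x) ≤ lam * g := by
            refine mul_le_mul_of_nonneg_left (sub_le_sub_right ?_ _) hlam.le
            exact le_max_right _ _
          unfold Model.excessLoss
          linarith
        refine (lintegral_mono h1).trans ?_
        rw [lintegral_const_mul' _ _ ENNReal.ofReal_ne_top]
        refine (mul_le_mul_right (hB.lintegral_exp_sq_loss_le ha hη hη4 _) _).trans ?_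
        rw [← ENNReal.ofReal_mul (Real.exp_pos _).le, ← Real.exp_add]
        refine ENNReal.ofReal_le_ofReal (Real.exp_le_exp.2 ?_)
        have := mul_le_mul_of_nonneg_left (hule θ) (by positivity : 0 ≤ 7 / 8 * η)
        linarith
    _ ≤ _ := by
        rw [← ofReal_integral_eq_lintegral_ofReal ?_ (.of_forall fun θ => (Real.exp_pos _).le)]
        · exact ENNReal.ofReal_le_ofReal (integral_exp_neg_add_le hum hgm hη (by linarith) hηb lam
            hu hg)
        · refine Integrable.of_bound (by fun_prop) (Real.exp (lam * b)) (.of_forall fun θ => ?_)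
          rw [Real.norm_of_nonneg (Real.exp_pos _).le]
          refine Real.exp_le_exp.2 ?_
          have h1 := mul_le_mul_of_nonneg_left (hg θ).2 hlam.le
          have h2 : 0 ≤ 7 / 8 * η * u θ := mul_nonneg (by positivity) (hu θ).1
          linarith

end Round

/-! ### Expectations under a conditional distribution -/

section CondDistrib

variable {W 𝓧 𝓨 : Type*} [MeasurableSpace W] [MeasurableSpace 𝓧] [MeasurableSpace 𝓨]
  {P : Measure W} [IsProbabilityMeasure P] {X : W → 𝓧} {Y : W → 𝓨} {κ : Kernel 𝓧 𝓨}
  [IsSFiniteKernel κ]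

theorem lintegral_of_hasCondDistrib (h : HasCondDistrib Y X κ P) {F : 𝓧 × 𝓨 → ℝ≥0∞}
    (hF : Measurable F) :
    ∫⁻ ω, F (X ω, Y ω) ∂P = ∫⁻ ω, ∫⁻ y, F (X ω, y) ∂(κ (X ω)) ∂P := by
  have hlaw : P.map (fun ω => (X ω, Y ω)) = (P.map X) ⊗ₘ κ := HasLaw.map_eq h
  have hae : AEMeasurable (fun ω => (X ω, Y ω)) P := HasLaw.aemeasurable h
  rw [← lintegral_map' hF.aemeasurable hae, hlaw, Measure.lintegral_compProd hF,
    lintegral_map' (Measurable.lintegral_kernel_prod_right' hF).aemeasurable h.aemeasurable_fst]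

theorem integral_of_hasCondDistrib (h : HasCondDistrib Y X κ P) {F : 𝓧 × 𝓨 → ℝ}
    (hF : Measurable F) (hi : Integrable (fun ω => F (X ω, Y ω)) P) :
    ∫ ω, F (X ω, Y ω) ∂P = ∫ ω, ∫ y, F (X ω, y) ∂(κ (X ω)) ∂P := by
  have hlaw : P.map (fun ω => (X ω, Y ω)) = (P.map X) ⊗ₘ κ := HasLaw.map_eq h
  have hae : AEMeasurable (fun ω => (X ω, Y ω)) P := HasLaw.aemeasurable h
  rw [← integral_map hae hF.aestronglyMeasurable, hlaw, Measure.integral_compProd, integral_map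
    h.aemeasurable_fst]
  · exact (StronglyMeasurable.integral_kernel_prod_right' hF.stronglyMeasurable).aestronglyMeasurable
  · rw [← hlaw]
    exact (integrable_map_measure hF.aestronglyMeasurable hae).2 hi

/-- A kernel that arises as a conditional distribution is Markov almost everywhere. -/
theorem ae_isProbabilityMeasure_of_hasCondDistrib (h : HasCondDistrib Y X κ P) :
    ∀ᵐ ω ∂P, IsProbabilityMeasure (κ (X ω)) := by
  have h1 : ∀ᵐ x ∂(P.map X), κ x Set.univ = 1 := by
    refine ae_eq_of_forall_setLIntegral_eq_of_sigmaFinite (κ.measurable_coe .univ)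
      measurable_const fun s hs _ => ?_
    have := lintegral_of_hasCondDistrib h (F := fun z => s.indicator 1 z.1)
      ((measurable_one.indicator hs).comp measurable_fst)
    simp only [lintegral_const] at this
    rw [← lintegral_indicator hs, ← lintegral_indicator hs,
      lintegral_map' ((κ.measurable_coe .univ).indicator hs).aemeasurable h.aemeasurable_fst,
      lintegral_map' (measurable_const.indicator hs).aemeasurable h.aemeasurable_fst]
    refine Eq.trans (lintegral_congr fun ω => ?_) (this.symm.trans (lintegral_congr fun ω => ?_))
    · by_cases hω : X ω ∈ s <;> simp [hω]
    · by_cases hω : X ω ∈ s <;> simp [hω]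
  filter_upwards [ae_of_ae_map h.aemeasurable_fst h1] with ω hω
  exact ⟨hω⟩

end CondDistrib

/-! ### The restricted posterior and the partition function -/

section Posterior

variable {Θ X A : Type*} [MeasurableSpace Θ] [MeasurableSpace X] [MeasurableSpace A]
  {B : Bandit X A} {M : Model Θ B} {η lam b : ℝ} {prior : Measure Θ} [IsProbabilityMeasure prior]

theorem Model.weight_nonneg {t : ℕ} (S : Set Θ) (h : History X A t) (θ : Θ) :
    0 ≤ M.weight η lam b S h θ :=
  Set.indicator_nonneg (fun _ _ => (Real.exp_pos _).le) _

theorem Model.measurable_weight {t : ℕ} {Ω : History X A t → X → Set Θ}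
    (hΩ : MeasurableSet {p : (History X A t × X) × Θ | p.2 ∈ Ω p.1.1 p.1.2}) :
    Measurable fun p : (History X A t × X) × Θ =>
      M.weight η lam b (Ω p.1.1 p.1.2) p.1.1 p.2 := by
  have h1 : ∀ i : Fin t, Measurable fun p : (History X A t × X) × Θ =>
      M.loss η lam b p.2 (p.1.1 i).1 (p.1.1 i).2.1 (p.1.1 i).2.2 := fun i =>
    (M.measurable_loss η lam b).comp (f := fun p : (History X A t × X) × Θ =>
      (p.2, (p.1.1 i).1, (p.1.1 i).2.1, (p.1.1 i).2.2)) (by fun_prop)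
  have h2 : Measurable fun p : (History X A t × X) × Θ =>
      Real.exp (-∑ i, M.loss η lam b p.2 (p.1.1 i).1 (p.1.1 i).2.1 (p.1.1 i).2.2) :=
    (Finset.measurable_sum _ fun i _ => h1 i).neg.exp
  exact h2.indicator hΩ

theorem Model.weight_le (hη : 0 < η) (hlam : 0 < lam) {t : ℕ} (S : Set Θ) (h : History X A t)
    (θ₀ : Θ) : M.weight η lam b S h θ₀ ≤ Real.exp (t * (lam * b)) := by
  refine Set.indicator_le' (fun θ _ => Real.exp_le_exp.2 ?_)
    (fun _ _ => (Real.exp_pos _).le) θ₀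
  rw [← Finset.sum_neg_distrib]
  calc _ ≤ ∑ _i : Fin t, lam * b := Finset.sum_le_sum fun i _ => M.neg_loss_le hη hlam b _ _ _ _
    _ = _ := by simp

theorem measurableSet_restriction {t : ℕ} {Ω : History X A t → X → Set Θ}
    (hΩ : MeasurableSet {p : (History X A t × X) × Θ | p.2 ∈ Ω p.1.1 p.1.2}) (h : History X A t)
    (x : X) : MeasurableSet (Ω h x) :=
  measurable_prodMk_left (x := (h, x)) hΩ

theorem Model.measurable_weight_right {t : ℕ} {Ω : History X A t → X → Set Θ}
    (hΩ : MeasurableSet {p : (History X A t × X) × Θ | p.2 ∈ Ω p.1.1 p.1.2}) (h : History X A t)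
    (x : X) : Measurable (M.weight η lam b (Ω h x) h) :=
  (M.measurable_weight hΩ).comp (measurable_prodMk_left (x := (h, x)))

theorem Model.integrable_weight (hη : 0 < η) (hlam : 0 < lam) {t : ℕ}
    {Ω : History X A t → X → Set Θ}
    (hΩ : MeasurableSet {p : (History X A t × X) × Θ | p.2 ∈ Ω p.1.1 p.1.2}) (h : History X A t)
    (x : X) : Integrable (M.weight η lam b (Ω h x) h) prior :=
  Integrable.of_mem_Icc 0 _ (M.measurable_weight_right hΩ h x).aemeasurable
    (.of_forall fun _ => ⟨M.weight_nonneg _ _ _, M.weight_le hη hlam _ _ _⟩)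

instance {t : ℕ} (Ω : History X A t → X → Set Θ) :
    IsSFiniteKernel (M.posterior η lam b prior t Ω) :=
  Kernel.IsSFiniteKernel.withDensity _ fun _ _ => ENNReal.ofReal_ne_top

theorem Model.posterior_apply {t : ℕ} {Ω : History X A t → X → Set Θ}
    (hΩ : MeasurableSet {p : (History X A t × X) × Θ | p.2 ∈ Ω p.1.1 p.1.2}) (h : History X A t)
    (x : X) : M.posterior η lam b prior t Ω (h, x) = prior.withDensity fun θ =>
      ENNReal.ofReal (M.weight η lam b (Ω h x) h θ / ∫ θ', M.weight η lam b (Ω h x) h θ' ∂prior) := by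
  rw [Model.posterior, Kernel.withDensity_apply]
  · simp
  · have h1 := M.measurable_weight (η := η) (lam := lam) (b := b) hΩ
    have h2 : Measurable fun p : History X A t × X =>
        ∫ θ', M.weight η lam b (Ω p.1 p.2) p.1 θ' ∂prior :=
      (StronglyMeasurable.integral_prod_right' (ν := prior) h1.stronglyMeasurable).measurable
    exact (h1.div (h2.comp measurable_fst)).ennreal_ofReal

theorem Model.integral_posterior {t : ℕ} {Ω : History X A t → X → Set Θ}
    (hΩ : MeasurableSet {p : (History X A t × X) × Θ | p.2 ∈ Ω p.1.1 p.1.2}) (h : History X A t)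
    (x : X) (g : Θ → ℝ) : ∫ θ, g θ ∂(M.posterior η lam b prior t Ω (h, x)) =
      (∫ θ, M.weight η lam b (Ω h x) h θ * g θ ∂prior) /
        ∫ θ, M.weight η lam b (Ω h x) h θ ∂prior := by
  have hm := M.measurable_weight_right (η := η) (lam := lam) (b := b) hΩ h x
  rw [M.posterior_apply hΩ, integral_withDensity_eq_integral_toReal_smul (by fun_prop)
    (.of_forall fun _ => ENNReal.ofReal_lt_top), ← integral_div]
  refine integral_congr_ae (.of_forall fun θ => ?_)
  simp only [smul_eq_mul]
  rw [ENNReal.toReal_ofReal (div_nonneg (M.weight_nonneg _ _ _)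
    (integral_nonneg fun _ => M.weight_nonneg _ _ _))]
  ring

theorem Model.posterior_compl {t : ℕ} {Ω : History X A t → X → Set Θ}
    (hΩ : MeasurableSet {p : (History X A t × X) × Θ | p.2 ∈ Ω p.1.1 p.1.2}) (h : History X A t)
    (x : X) : M.posterior η lam b prior t Ω (h, x) (Ω h x)ᶜ = 0 := by
  rw [M.posterior_apply hΩ, withDensity_apply _ (measurableSet_restriction hΩ h x).compl]
  refine (setLIntegral_congr_fun (measurableSet_restriction hΩ h x).compl fun θ hθ => ?_).trans
    lintegral_zero
  simp [Model.weight, Set.indicator_of_notMem hθ]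

theorem Model.integral_weight_pos {t : ℕ} {Ω : History X A t → X → Set Θ}
    (hΩ : MeasurableSet {p : (History X A t × X) × Θ | p.2 ∈ Ω p.1.1 p.1.2}) (h : History X A t)
    (x : X) [hp : IsProbabilityMeasure (M.posterior η lam b prior t Ω (h, x))] :
    0 < ∫ θ, M.weight η lam b (Ω h x) h θ ∂prior := by
  refine lt_of_le_of_ne (integral_nonneg fun _ => M.weight_nonneg _ _ _) fun h0 => ?_
  have h1 := hp.measure_univ
  rw [M.posterior_apply hΩ, ← h0] at h1
  simp at h1

/-- The partition function of the excess losses, whose logarithm is `Model.logPartition`. -/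
def Model.partitionFn (M : Model Θ B) (η lam b : ℝ) (prior : Measure Θ)
    (Ω : (t : ℕ) → History X A t → X → Set Θ) (t : ℕ) (h : History X A t) : ℝ :=
  ∫ θ, (activeSet Ω t h).indicator
    (fun θ => Real.exp (-∑ i, M.excessLoss η lam b θ (h i).1 (h i).2.1 (h i).2.2)) θ ∂prior

theorem Model.exp_neg_sum_excessLoss {t : ℕ} (h : History X A t) (θ : Θ) :
    Real.exp (-∑ i, M.excessLoss η lam b θ (h i).1 (h i).2.1 (h i).2.2) =
      Real.exp (-∑ i, (lam * B.optValue (h i).1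
        - η * (B.value (h i).1 (h i).2.1 - (h i).2.2) ^ 2)) *
      Real.exp (-∑ i, M.loss η lam b θ (h i).1 (h i).2.1 (h i).2.2) := by
  rw [← Real.exp_add]
  congr 1
  simp_rw [M.excessLoss_eq, Finset.sum_add_distrib]
  ring

theorem measurableSet_activeSet {Ω : (t : ℕ) → History X A t → X → Set Θ}
    (hΩ : ∀ t, MeasurableSet {p : (History X A t × X) × Θ | p.2 ∈ Ω t p.1.1 p.1.2}) (t : ℕ)
    (h : History X A t) : MeasurableSet (activeSet Ω t h) := by
  cases t with
  | zero => exact .univ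
  | succ t => exact measurableSet_restriction (hΩ t) _ _

/-- One factor of the telescoping product: the partition function grows at most by the posterior
expectation of the exponential of the negative excess loss of the last round, and stays positive
as long as the posterior exists. -/
theorem Model.partitionFn_succ (hη : 0 < η) (hlam : 0 < lam)
    {Ω : (t : ℕ) → History X A t → X → Set Θ}
    (hΩ : ∀ t, MeasurableSet {p : (History X A t × X) × Θ | p.2 ∈ Ω t p.1.1 p.1.2}) {t : ℕ}
    (h : History X A (t + 1))
    [IsProbabilityMeasure (M.posterior η lam b prior t (Ω t) (Fin.init h, (h (Fin.last t)).1))]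
    (hsub : Ω t (Fin.init h) (h (Fin.last t)).1 ⊆ activeSet Ω t (Fin.init h)) :
    0 < M.partitionFn η lam b prior Ω (t + 1) h ∧
    0 < ∫ θ, Real.exp (-M.excessLoss η lam b θ (h (Fin.last t)).1 (h (Fin.last t)).2.1
      (h (Fin.last t)).2.2) ∂(M.posterior η lam b prior t (Ω t)
        (Fin.init h, (h (Fin.last t)).1)) ∧
    M.partitionFn η lam b prior Ω (t + 1) h ≤ M.partitionFn η lam b prior Ω t (Fin.init h) *
      ∫ θ, Real.exp (-M.excessLoss η lam b θ (h (Fin.last t)).1 (h (Fin.last t)).2.1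
        (h (Fin.last t)).2.2) ∂(M.posterior η lam b prior t (Ω t)
          (Fin.init h, (h (Fin.last t)).1)) := by
  set h' : History X A t := Fin.init h with hh'
  set x := (h (Fin.last t)).1 with hx
  set a := (h (Fin.last t)).2.1
  set r := (h (Fin.last t)).2.2
  set Y := ∫ θ, Real.exp (-M.excessLoss η lam b θ x a r)
    ∂(M.posterior η lam b prior t (Ω t) (h', x)) with hY
  set w := M.weight η lam b (Ω t h' x) h' with hw
  set C := Real.exp (-∑ i, (lam * B.optValue (h' i).1
    - η * (B.value (h' i).1 (h' i).2.1 - (h' i).2.2) ^ 2)) with hC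
  have hCpos : 0 < C := Real.exp_pos _
  have hZpos : 0 < ∫ θ, w θ ∂prior := M.integral_weight_pos (hΩ t) h' x
  have hYpos : 0 < Y := integral_exp_pos (M.integrable_exp_neg_excessLoss hη hlam b x a r _)
  have hYeq : Y * ∫ θ, w θ ∂prior =
      ∫ θ, w θ * Real.exp (-M.excessLoss η lam b θ x a r) ∂prior := by
    rw [hY, M.integral_posterior (hΩ t), div_mul_cancel₀ _ hZpos.ne']
  have heq : M.partitionFn η lam b prior Ω (t + 1) h = C * (Y * ∫ θ, w θ ∂prior) := by
    rw [hYeq, ← integral_const_mul]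
    refine integral_congr_ae (.of_forall fun θ => ?_)
    change (Ω t h' x).indicator _ θ = C * (w θ * _)
    by_cases hθ : θ ∈ Ω t h' x
    · rw [Set.indicator_of_mem hθ, hw, Model.weight, Set.indicator_of_mem hθ, ← mul_assoc, hC,
        ← M.exp_neg_sum_excessLoss h' θ, Fin.sum_univ_castSucc, neg_add, Real.exp_add]
      rfl
    · rw [Set.indicator_of_notMem hθ, hw, Model.weight, Set.indicator_of_notMem hθ]
      ring
  have hle : C * ∫ θ, w θ ∂prior ≤ M.partitionFn η lam b prior Ω t h' := by
    have hm : ∀ i, Measurable fun θ =>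
        M.loss η lam b θ (h' i).1 (h' i).2.1 (h' i).2.2 := fun i =>
      (M.measurable_loss η lam b).comp
        (f := fun θ : Θ => (θ, (h' i).1, (h' i).2.1, (h' i).2.2)) (by fun_prop)
    have hfull : Integrable (fun θ => C * M.weight η lam b (activeSet Ω t h') h' θ) prior := by
      refine Integrable.const_mul (Integrable.of_mem_Icc 0 (Real.exp (t * (lam * b)))
        (Measurable.aemeasurable ?_) (.of_forall fun θ =>
          ⟨M.weight_nonneg _ _ _, M.weight_le hη hlam _ _ _⟩)) C
      exact ((Finset.measurable_sum _ fun i _ => hm i).neg.exp).indicator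
        (measurableSet_activeSet hΩ t h')
    have hpart : M.partitionFn η lam b prior Ω t h' =
        ∫ θ, C * M.weight η lam b (activeSet Ω t h') h' θ ∂prior := by
      refine integral_congr_ae (.of_forall fun θ => ?_)
      simp only [M.exp_neg_sum_excessLoss, Model.weight]
      by_cases hθ : θ ∈ activeSet Ω t h'
      · simp only [Set.indicator_of_mem hθ, hC]
      · simp only [Set.indicator_of_notMem hθ, mul_zero]
    rw [hpart, ← integral_const_mul]
    refine integral_mono ((M.integrable_weight hη hlam (hΩ t) h' x).const_mul C) hfull
      fun θ => mul_le_mul_of_nonneg_left ?_ hCpos.le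
    exact Set.indicator_le_indicator_of_subset hsub (fun _ => (Real.exp_pos _).le) θ
  refine ⟨by rw [heq]; positivity, hYpos, ?_⟩
  rw [heq]
  calc C * (Y * ∫ θ, w θ ∂prior) = (C * ∫ θ, w θ ∂prior) * Y := by ring
    _ ≤ _ := mul_le_mul_of_nonneg_right hle hYpos.le

end Posterior

/-! ### The log-partition function along a run -/

section Run

variable {Θ X A W : Type*} [MeasurableSpace Θ] [MeasurableSpace X] [MeasurableSpace A]
  {B : Bandit X A} {M : Model Θ B} {η lam b : ℝ} {prior : Measure Θ}
  [IsProbabilityMeasure prior] {Ω : (t : ℕ) → History X A t → X → Set Θ} {T : ℕ}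
  {R : Run Θ X W} {u : Θ → X → A → ℝ}

theorem Run.action_mem (R : Run Θ X W) (M : Model Θ B) (t : ℕ) (ω : W) :
    R.action M t ω ∈ B.actions (R.x t ω) :=
  M.greedy_mem _ _

/-- `u` is a lower bound of the squared error of the value functions, with values in
`[0, (b + 1) ^ 2]`, at the allowable actions. The squared error of the truncated value function is
an example. -/
structure Model.IsErrorBound (M : Model Θ B) (b : ℝ) (u : Θ → X → A → ℝ) : Prop where
  measurable : Measurable fun p : Θ × X × A => u p.1 p.2.1 p.2.2
  mem : ∀ θ x, ∀ a ∈ B.actions x, u θ x a ∈ Set.Icc 0 ((b + 1) ^ 2)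
  le : ∀ θ x, ∀ a ∈ B.actions x, u θ x a ≤ (M.f θ x a - B.value x a) ^ 2

theorem Model.isErrorBound_trunc (M : Model Θ B) (hB : B.SubGaussianRewards) (hb : 1 ≤ b) :
    M.IsErrorBound b fun θ x a => (M.trunc b θ x a - B.value x a) ^ 2 where
  measurable := ((M.measurable_trunc b).sub (B.measurable_value.comp measurable_snd)).pow_const 2
  mem θ _ _ ha := M.trunc_sub_value_sq_mem hB (by linarith) θ ha
  le θ _ _ ha := M.trunc_sub_value_sq_le hB hb θ ha

/-- The restricted posterior in force in round `t`. -/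
def Run.post (R : Run Θ X W) (M : Model Θ B) (η lam b : ℝ) (prior : Measure Θ) [SFinite prior]
    (Ω : (t : ℕ) → History X A t → X → Set Θ) (t : ℕ) (ω : W) : Measure Θ :=
  M.posterior η lam b prior t (Ω t) (R.hist M t ω, R.x t ω)

variable [MeasurableSpace W] {P : Measure W}

/-- The expectation of `u` at `(x_t, a_t)` for a parameter drawn from the posterior independently
of `a_t`; for the squared error of the truncated value function this is `Run.expLS`. -/
def Run.expErr (R : Run Θ X W) (M : Model Θ B) (η lam b : ℝ) (prior : Measure Θ) [SFinite prior]
    (Ω : (t : ℕ) → History X A t → X → Set Θ) (P : Measure W) (u : Θ → X → A → ℝ) (t : ℕ) : ℝ :=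
  ∫ ω, ∫ θ, u θ (R.x t ω) (R.action M t ω) ∂(R.post M η lam b prior Ω t ω) ∂P

/-- The exponent that bounds one round: a bound for the logarithm of the conditional expectation,
given the context and the action, of `E exp (-ΔL)` for parameters drawn from `p`. -/
def Model.roundExponent (M : Model Θ B) (η lam b : ℝ) (u : Θ → X → A → ℝ) (p : Measure Θ) (x : X)
    (a : A) : ℝ :=
  lam * ∫ θ, (M.truncMax b θ x - B.optValue x) ∂p - 0.25 * η * ∫ θ, u θ x a ∂p
    + 1.5 * lam ^ 2 * (b + 1) ^ 2

/-- The posterior expectation of `exp (-ΔL)` at the context, action and reward of round `t`. -/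
def Run.expLik (R : Run Θ X W) (M : Model Θ B) (η lam b : ℝ) (prior : Measure Θ) [SFinite prior]
    (Ω : (t : ℕ) → History X A t → X → Set Θ) (t : ℕ) (ω : W) : ℝ :=
  ∫ θ, Real.exp (-M.excessLoss η lam b θ (R.x t ω) (R.action M t ω) (R.r t ω))
    ∂(R.post M η lam b prior Ω t ω)

/-- `Model.roundExponent` in round `t` of a run. -/
def Run.exponent (R : Run Θ X W) (M : Model Θ B) (η lam b : ℝ) (prior : Measure Θ) [SFinite prior]
    (Ω : (t : ℕ) → History X A t → X → Set Θ) (u : Θ → X → A → ℝ) (t : ℕ) (ω : W) : ℝ :=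
  M.roundExponent η lam b u (R.post M η lam b prior Ω t ω) (R.x t ω) (R.action M t ω)

theorem Run.IsFeelGoodTS.aemeasurable_param (hR : R.IsFeelGoodTS M η lam b prior Ω T P) {t : ℕ}
    (ht : t < T) : AEMeasurable (fun ω => ((R.hist M t ω, R.x t ω), R.θ t ω)) P :=
  HasLaw.aemeasurable (hR.param t ht)

theorem Run.IsFeelGoodTS.aemeasurable_reward (hR : R.IsFeelGoodTS M η lam b prior Ω T P) {t : ℕ}
    (ht : t < T) :
    AEMeasurable (fun ω => ((R.hist M t ω, R.x t ω, R.action M t ω), R.r t ω)) P :=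
  HasLaw.aemeasurable (hR.reward t ht)

variable [IsProbabilityMeasure P]

theorem Run.IsFeelGoodTS.ae_isProbabilityMeasure_post
    (hR : R.IsFeelGoodTS M η lam b prior Ω T P) {t : ℕ} (ht : t < T) :
    ∀ᵐ ω ∂P, IsProbabilityMeasure (R.post M η lam b prior Ω t ω) :=
  ae_isProbabilityMeasure_of_hasCondDistrib (hR.param t ht)

/-- Posterior expectations depend measurably on the history, the context and further data. -/
theorem Model.measurable_integral_posterior {Y : Type*} [MeasurableSpace Y] {t : ℕ}
    {Ω : History X A t → X → Set Θ} {k : Y → History X A t × X} (hk : Measurable k)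
    {F : Y × Θ → ℝ} (hF : Measurable F) :
    Measurable fun y => ∫ θ, F (y, θ) ∂(M.posterior η lam b prior t Ω (k y)) :=
  (StronglyMeasurable.integral_kernel_prod_right'
    (κ := (M.posterior η lam b prior t Ω).comap k hk) hF.stronglyMeasurable).measurable

theorem Model.measurable_truncMax_sub_optValue (M : Model Θ B) (hopt : Measurable B.optValue)
    (b : ℝ) : Measurable fun p : Θ × X => M.truncMax b p.1 p.2 - B.optValue p.2 :=
  (M.measurable_truncMax b).sub (hopt.comp measurable_snd)

theorem Model.measurable_roundExponent (hopt : Measurable B.optValue) (hu : M.IsErrorBound b u)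
    {t : ℕ} (Ω : History X A t → X → Set Θ) :
    Measurable fun z : History X A t × X × A =>
      M.roundExponent η lam b u (M.posterior η lam b prior t Ω (z.1, z.2.1)) z.2.1 z.2.2 := by
  have hk : Measurable fun z : History X A t × X × A => (z.1, z.2.1) := by fun_prop
  have h1 := M.measurable_integral_posterior (η := η) (lam := lam) (b := b) (prior := prior)
    (Ω := Ω) hk ((M.measurable_truncMax_sub_optValue hopt b).comp
      (f := fun q : (History X A t × X × A) × Θ => (q.2, q.1.2.1)) (by fun_prop))
  have h2 := M.measurable_integral_posterior (η := η) (lam := lam) (b := b) (prior := prior)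
    (Ω := Ω) hk (hu.measurable.comp
      (f := fun q : (History X A t × X × A) × Θ => (q.2, q.1.2.1, q.1.2.2)) (by fun_prop))
  exact ((h1.const_mul _).sub (h2.const_mul _)).add_const _

theorem Model.measurable_expLik (hopt : Measurable B.optValue) {t : ℕ}
    (Ω : History X A t → X → Set Θ) :
    Measurable fun z : (History X A t × X × A) × ℝ =>
      ∫ θ, Real.exp (-M.excessLoss η lam b θ z.1.2.1 z.1.2.2 z.2)
        ∂(M.posterior η lam b prior t Ω (z.1.1, z.1.2.1)) :=
  M.measurable_integral_posterior (η := η) (lam := lam) (b := b) (prior := prior)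
    (Ω := Ω) (k := fun z : (History X A t × X × A) × ℝ => (z.1.1, z.1.2.1)) (by fun_prop)
    ((M.measurable_excessLoss hopt η lam b).comp
      (f := fun q : ((History X A t × X × A) × ℝ) × Θ => (q.2, q.1.1.2.1, q.1.1.2.2, q.1.2))
      (by fun_prop)).neg.exp

theorem abs_integral_le_of_abs_le {p : Measure Θ} [IsProbabilityMeasure p] {g : Θ → ℝ} {C : ℝ}
    (hg : ∀ θ, |g θ| ≤ C) : |∫ θ, g θ ∂p| ≤ C := by
  simpa using norm_integral_le_of_norm_le_const (μ := p) (f := g) (.of_forall fun θ => hg θ)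

instance (t : ℕ) : IsMarkovKernel (B.rewardGiven t) := by
  unfold Bandit.rewardGiven
  infer_instance

/-- The normalized likelihood of a round has expectation at most one. -/
theorem Run.IsFeelGoodTS.integral_expLik_mul_exp_neg_le
    (hR : R.IsFeelGoodTS M η lam b prior Ω T P) (hopt : Measurable B.optValue)
    (hB : B.SubGaussianRewards) (hb : 1 ≤ b) (hη : 0 < η) (hηb : η ≤ 1 / (b + 1) ^ 2)
    (hlam : 0 < lam) (hu : M.IsErrorBound b u) {t : ℕ} (ht : t < T) :
    Integrable (fun ω => R.expLik M η lam b prior Ω t ω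
      * Real.exp (-R.exponent M η lam b prior Ω u t ω)) P ∧
    ∫ ω, R.expLik M η lam b prior Ω t ω
      * Real.exp (-R.exponent M η lam b prior Ω u t ω) ∂P ≤ 1 := by
  have hFm : Measurable fun z : (History X A t × X × A) × ℝ =>
      (∫ θ, Real.exp (-M.excessLoss η lam b θ z.1.2.1 z.1.2.2 z.2)
        ∂(M.posterior η lam b prior t (Ω t) (z.1.1, z.1.2.1))) *
      Real.exp (-M.roundExponent η lam b u
        (M.posterior η lam b prior t (Ω t) (z.1.1, z.1.2.1)) z.1.2.1 z.1.2.2) :=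
    (M.measurable_expLik hopt (Ω t)).mul
      ((M.measurable_roundExponent hopt hu (Ω t)).comp measurable_fst).neg.exp
  have hnn : ∀ ω, 0 ≤ R.expLik M η lam b prior Ω t ω
      * Real.exp (-R.exponent M η lam b prior Ω u t ω) := fun ω =>
    mul_nonneg (integral_nonneg fun _ => (Real.exp_pos _).le) (Real.exp_pos _).le
  have hae : AEStronglyMeasurable (fun ω => R.expLik M η lam b prior Ω t ω
      * Real.exp (-R.exponent M η lam b prior Ω u t ω)) P :=
    (hFm.comp_aemeasurable (hR.aemeasurable_reward ht)).aestronglyMeasurable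
  have hle : ∫⁻ ω, ENNReal.ofReal (R.expLik M η lam b prior Ω t ω
      * Real.exp (-R.exponent M η lam b prior Ω u t ω)) ∂P ≤ 1 := by
    calc _ = ∫⁻ ω, ∫⁻ r, ENNReal.ofReal ((∫ θ, Real.exp (-M.excessLoss η lam b θ (R.x t ω)
          (R.action M t ω) r) ∂(R.post M η lam b prior Ω t ω)) *
          Real.exp (-R.exponent M η lam b prior Ω u t ω))
          ∂(B.reward (R.x t ω, R.action M t ω)) ∂P :=
          lintegral_of_hasCondDistrib (hR.reward t ht) hFm.ennreal_ofReal
      _ ≤ ∫⁻ _, 1 ∂P := by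
          refine lintegral_mono_ae ?_
          filter_upwards [hR.ae_isProbabilityMeasure_post ht] with ω hω
          simp_rw [fun r => ENNReal.ofReal_mul (p := ∫ θ, Real.exp (-M.excessLoss η lam b θ
            (R.x t ω) (R.action M t ω) r) ∂(R.post M η lam b prior Ω t ω))
            (q := Real.exp (-R.exponent M η lam b prior Ω u t ω))
            (integral_nonneg fun _ => (Real.exp_pos _).le)]
          rw [lintegral_mul_const' _ _ ENNReal.ofReal_ne_top]
          refine (mul_le_mul_left (M.lintegral_integral_exp_neg_excessLoss_le hopt hB hb hη hηb
            hlam (R.action_mem M t ω) (R.post M η lam b prior Ω t ω)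
            (u := fun θ => u θ (R.x t ω) (R.action M t ω))
            (hu.measurable.comp (f := fun θ : Θ => (θ, R.x t ω, R.action M t ω)) (by fun_prop))
            (fun θ => hu.mem θ _ _ (R.action_mem M t ω))
            (fun θ => hu.le θ _ _ (R.action_mem M t ω))) _).trans_eq ?_
          rw [← ENNReal.ofReal_mul (Real.exp_pos _).le, ← Real.exp_add, Run.exponent,
            Model.roundExponent, add_neg_cancel, Real.exp_zero, ENNReal.ofReal_one]
      _ = 1 := by simp
  have hint : Integrable (fun ω => R.expLik M η lam b prior Ω t ω
      * Real.exp (-R.exponent M η lam b prior Ω u t ω)) P :=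
    ⟨hae, (hasFiniteIntegral_iff_ofReal (.of_forall hnn)).2 (hle.trans_lt ENNReal.one_lt_top)⟩
  refine ⟨hint, ?_⟩
  rw [← ENNReal.ofReal_le_one, ofReal_integral_eq_lintegral_ofReal hint (.of_forall hnn)]
  exact hle

theorem Run.IsFeelGoodTS.expFG_eq (hR : R.IsFeelGoodTS M η lam b prior Ω T P)
    (hopt : Measurable B.optValue) (hB : B.SubGaussianRewards) (hb : 1 ≤ b) {t : ℕ}
    (ht : t < T) : R.expFG M b P t = ∫ ω, ∫ θ, (M.truncMax b θ (R.x t ω)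
      - B.optValue (R.x t ω)) ∂(R.post M η lam b prior Ω t ω) ∂P := by
  have hF : Measurable fun z : (History X A t × X) × Θ =>
      M.truncMax b z.2 z.1.2 - B.optValue z.1.2 :=
    (M.measurable_truncMax_sub_optValue hopt b).comp
      (f := fun z : (History X A t × X) × Θ => (z.2, z.1.2)) (by fun_prop)
  exact integral_of_hasCondDistrib (hR.param t ht) hF (Integrable.of_mem_Icc (-(b + 1)) b
    (hF.comp_aemeasurable (hR.aemeasurable_param ht))
    (.of_forall fun ω => M.truncMax_sub_optValue_mem hB (by linarith) _ _))

theorem Run.IsFeelGoodTS.integrable_exponent (hR : R.IsFeelGoodTS M η lam b prior Ω T P)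
    (hopt : Measurable B.optValue) (hB : B.SubGaussianRewards) (hb : 1 ≤ b)
    (hu : M.IsErrorBound b u) {t : ℕ} (ht : t < T) :
    Integrable (fun ω => R.exponent M η lam b prior Ω u t ω) P ∧
    ∫ ω, R.exponent M η lam b prior Ω u t ω ∂P = lam * R.expFG M b P t
      - 0.25 * η * R.expErr M η lam b prior Ω P u t + 1.5 * lam ^ 2 * (b + 1) ^ 2 := by
  have hk : Measurable fun z : History X A t × X × A => (z.1, z.2.1) := by fun_prop
  have hz : AEMeasurable (fun ω => (R.hist M t ω, R.x t ω, R.action M t ω)) P :=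
    (hR.aemeasurable_reward ht).fst
  have m1 := M.measurable_integral_posterior (η := η) (lam := lam) (b := b) (prior := prior)
    (Ω := Ω t) hk ((M.measurable_truncMax_sub_optValue hopt b).comp
      (f := fun q : (History X A t × X × A) × Θ => (q.2, q.1.2.1)) (by fun_prop))
  have m2 := M.measurable_integral_posterior (η := η) (lam := lam) (b := b) (prior := prior)
    (Ω := Ω t) hk (hu.measurable.comp
      (f := fun q : (History X A t × X × A) × Θ => (q.2, q.1.2.1, q.1.2.2)) (by fun_prop))
  have i1 : Integrable (fun ω => ∫ θ, (M.truncMax b θ (R.x t ω) - B.optValue (R.x t ω))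
      ∂(R.post M η lam b prior Ω t ω)) P := by
    refine Integrable.of_bound (m1.comp_aemeasurable hz).aestronglyMeasurable (b + 1) ?_
    filter_upwards [hR.ae_isProbabilityMeasure_post ht] with ω hω
    refine abs_integral_le_of_abs_le fun θ => abs_le.2 ?_
    have := M.truncMax_sub_optValue_mem hB (by linarith : 0 ≤ b) θ (R.x t ω)
    exact ⟨this.1, this.2.trans (by linarith)⟩
  have i2 : Integrable (fun ω => ∫ θ, u θ (R.x t ω) (R.action M t ω)
      ∂(R.post M η lam b prior Ω t ω)) P := by
    refine Integrable.of_bound (m2.comp_aemeasurable hz).aestronglyMeasurable ((b + 1) ^ 2) ?_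
    filter_upwards [hR.ae_isProbabilityMeasure_post ht] with ω hω
    refine abs_integral_le_of_abs_le fun θ => ?_
    have := hu.mem θ _ _ (R.action_mem M t ω)
    rw [abs_of_nonneg this.1]
    exact this.2
  have i3 : Integrable (fun ω =>
      lam * ∫ θ, (M.truncMax b θ (R.x t ω) - B.optValue (R.x t ω)) ∂(R.post M η lam b prior Ω t ω)
      - 0.25 * η * ∫ θ, u θ (R.x t ω) (R.action M t ω) ∂(R.post M η lam b prior Ω t ω)) P :=
    (i1.const_mul _).sub (i2.const_mul _)
  refine ⟨i3.add (integrable_const _), ?_⟩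
  rw [hR.expFG_eq hopt hB hb ht, Run.expErr]
  simp only [Run.exponent, Model.roundExponent]
  rw [integral_add i3 (integrable_const _),
    integral_sub (i1.const_mul _) (i2.const_mul _), integral_const_mul, integral_const_mul]
  simp

/-- The telescoped bound for the log-partition function. -/
theorem Run.IsFeelGoodTS.ae_logPartition_le (hR : R.IsFeelGoodTS M η lam b prior Ω T P)
    (hη : 0 < η) (hlam : 0 < lam)
    (hΩ : ∀ t, MeasurableSet {p : (History X A t × X) × Θ | p.2 ∈ Ω t p.1.1 p.1.2})
    (hnested : ∀ t < T, ∀ᵐ ω ∂P,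
      Ω t (R.hist M t ω) (R.x t ω) ⊆ activeSet Ω t (R.hist M t ω)) {t : ℕ} (ht : t ≤ T) :
    ∀ᵐ ω ∂P, 0 < M.partitionFn η lam b prior Ω t (R.hist M t ω) ∧
      (∀ s < t, 0 < R.expLik M η lam b prior Ω s ω) ∧
      M.logPartition η lam b prior Ω t (R.hist M t ω) ≤
        ∑ s ∈ Finset.range t, Real.log (R.expLik M η lam b prior Ω s ω) := by
  induction t with
  | zero =>
    refine .of_forall fun ω => ?_
    simp [Model.partitionFn, Model.logPartition, activeSet]
  | succ t ih =>
    filter_upwards [ih (by omega), hnested t (by omega), hR.ae_isProbabilityMeasure_post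
      (show t < T by omega)] with ω h1 h2 h3
    have : IsProbabilityMeasure (M.posterior η lam b prior t (Ω t)
      (Fin.init (R.hist M (t + 1) ω), (R.hist M (t + 1) ω (Fin.last t)).1)) := h3
    obtain ⟨k1, k2, k3⟩ := M.partitionFn_succ (b := b) (prior := prior) hη hlam hΩ (R.hist M (t + 1) ω) h2
    have k2' : 0 < R.expLik M η lam b prior Ω t ω := k2
    have k3' : M.partitionFn η lam b prior Ω (t + 1) (R.hist M (t + 1) ω) ≤
      M.partitionFn η lam b prior Ω t (R.hist M t ω) * R.expLik M η lam b prior Ω t ω := k3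
    refine ⟨k1, fun s hs => ?_, ?_⟩
    · rcases Nat.lt_succ_iff_lt_or_eq.1 hs with hs | rfl
      · exact h1.2.1 s hs
      · exact k2'
    · have h4 := Real.log_le_log k1 k3'
      rw [Real.log_mul h1.1.ne' k2'.ne'] at h4
      rw [Finset.sum_range_succ]
      exact h4.trans (add_le_add_left h1.2.2 _)

theorem extExp_le_integral {m : Measure W} {Y U : W → ℝ} (hU : Integrable U m) (h : ∀ᵐ ω ∂m, Y ω ≤ U ω) :
    extExp m Y ≤ ((∫ ω, U ω ∂m : ℝ) : EReal) := by
  have h1 : ∫⁻ ω, ENNReal.ofReal (Y ω) ∂m ≤ ∫⁻ ω, ENNReal.ofReal (U ω) ∂m :=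
    lintegral_mono_ae (h.mono fun ω hω => ENNReal.ofReal_le_ofReal hω)
  have h2 : ∫⁻ ω, ENNReal.ofReal (-U ω) ∂m ≤ ∫⁻ ω, ENNReal.ofReal (-Y ω) ∂m :=
    lintegral_mono_ae (h.mono fun ω hω => ENNReal.ofReal_le_ofReal (neg_le_neg hω))
  have hfin : ∀ V : W → ℝ, Integrable V m → ∫⁻ ω, ENNReal.ofReal (V ω) ∂m ≠ ⊤ := fun V hV =>
    hV.lintegral_lt_top.ne
  rw [integral_eq_lintegral_pos_part_sub_lintegral_neg_part hU, EReal.coe_sub,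
    EReal.coe_ennreal_toReal (hfin _ hU), EReal.coe_ennreal_toReal (hfin (fun ω => -U ω) hU.neg)]
  exact EReal.sub_le_sub (EReal.coe_ennreal_le_coe_ennreal_iff.2 h1)
    (EReal.coe_ennreal_le_coe_ennreal_iff.2 h2)

/-- The bound on the expected log-partition function. Each `log y` is bounded by its tangent
`y e^{-c} - 1 + c` at `e ^ c`, where `c = Run.exponent` is determined before the reward is drawn;
this makes the upper bound integrable without any lower bound on the log-partition function. -/
theorem Run.IsFeelGoodTS.extExp_logPartition_le (hR : R.IsFeelGoodTS M η lam b prior Ω T P)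
    (hopt : Measurable B.optValue) (hB : B.SubGaussianRewards) (hb : 1 ≤ b) (hη : 0 < η)
    (hηb : η ≤ 1 / (b + 1) ^ 2) (hlam : 0 < lam)
    (hΩ : ∀ t, MeasurableSet {p : (History X A t × X) × Θ | p.2 ∈ Ω t p.1.1 p.1.2})
    (hnested : ∀ t < T, ∀ᵐ ω ∂P,
      Ω t (R.hist M t ω) (R.x t ω) ⊆ activeSet Ω t (R.hist M t ω))
    (hu : M.IsErrorBound b u) :
    (∫⁻ ω, ENNReal.ofReal (M.logPartition η lam b prior Ω T (R.hist M T ω)) ∂P ≠ ⊤) ∧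
    extExp P (fun ω => M.logPartition η lam b prior Ω T (R.hist M T ω)) ≤
      ((∑ t ∈ Finset.range T, (lam * R.expFG M b P t
        - 0.25 * η * R.expErr M η lam b prior Ω P u t + 1.5 * lam ^ 2 * (b + 1) ^ 2) : ℝ)
          : EReal) := by
  have hY := fun t (ht : t ∈ Finset.range T) =>
    hR.integral_expLik_mul_exp_neg_le hopt hB hb hη hηb hlam hu (Finset.mem_range.1 ht)
  have hG := fun t (ht : t ∈ Finset.range T) =>
    hR.integrable_exponent hopt hB hb hu (Finset.mem_range.1 ht)
  have hi : ∀ t ∈ Finset.range T, Integrable (fun ω => R.expLik M η lam b prior Ω t ω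
      * Real.exp (-R.exponent M η lam b prior Ω u t ω) - 1
      + R.exponent M η lam b prior Ω u t ω) P := fun t ht =>
    ((hY t ht).1.sub (integrable_const 1)).add (hG t ht).1
  have hU : Integrable (fun ω => ∑ t ∈ Finset.range T, (R.expLik M η lam b prior Ω t ω
      * Real.exp (-R.exponent M η lam b prior Ω u t ω) - 1
      + R.exponent M η lam b prior Ω u t ω)) P := integrable_finsetSum _ hi
  have hle : ∀ᵐ ω ∂P, M.logPartition η lam b prior Ω T (R.hist M T ω) ≤
      ∑ t ∈ Finset.range T, (R.expLik M η lam b prior Ω t ω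
      * Real.exp (-R.exponent M η lam b prior Ω u t ω) - 1
      + R.exponent M η lam b prior Ω u t ω) := by
    filter_upwards [hR.ae_logPartition_le hη hlam hΩ hnested le_rfl] with ω hω
    refine hω.2.2.trans (Finset.sum_le_sum fun t ht => ?_)
    have hpos := hω.2.1 t (Finset.mem_range.1 ht)
    have := Real.log_le_sub_one_of_pos
      (mul_pos hpos (Real.exp_pos (-R.exponent M η lam b prior Ω u t ω)))
    rw [Real.log_mul hpos.ne' (Real.exp_pos _).ne', Real.log_exp] at this
    linarith
  refine ⟨((lintegral_mono_ae (hle.mono fun ω hω => ENNReal.ofReal_le_ofReal hω)).trans_lt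
    hU.lintegral_lt_top).ne, (extExp_le_integral hU hle).trans (EReal.coe_le_coe_iff.2 ?_)⟩
  rw [integral_finsetSum _ hi]
  refine Finset.sum_le_sum fun t ht => ?_
  have hY1 : Integrable (fun ω => R.expLik M η lam b prior Ω t ω
      * Real.exp (-R.exponent M η lam b prior Ω u t ω) - 1) P := (hY t ht).1.sub (integrable_const 1)
  rw [integral_add hY1 (hG t ht).1,
    integral_sub (hY t ht).1 (integrable_const 1), (hG t ht).2]
  have := (hY t ht).2
  simp only [integral_const, probReal_univ, smul_eq_mul, mul_one]
  linarith

end Run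

/-! ### Regret and decoupling -/

section Regret

variable {Θ X A W : Type*} [MeasurableSpace Θ] [MeasurableSpace X] [MeasurableSpace A]
  [MeasurableSpace W] {B : Bandit X A} {M : Model Θ B} {η lam b : ℝ} {prior : Measure Θ}
  [IsProbabilityMeasure prior] {Ω : (t : ℕ) → History X A t → X → Set Θ} {T : ℕ}
  {P : Measure W} [IsProbabilityMeasure P] {R : Run Θ X W} {u : Θ → X → A → ℝ}

/-- The defect in the decoupling inequality at the context `x` for parameters with law `p`, with
the errors measured by `u` and without the term that involves the decoupling coefficient. -/
def Model.decouplingGap (M : Model Θ B) (b μ : ℝ) (u : Θ → X → A → ℝ) (p : Measure Θ) (x : X) : ℝ :=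
  ∫ θ, (M.truncMax b θ x - B.value x (M.greedy θ x)) ∂p
    - μ * ∫ θ', ∫ θ, u θ x (M.greedy θ' x) ∂p ∂p

theorem Model.ofReal_decouplingGap_le_dc (M : Model Θ B) {μ : ℝ} (hμ : 0 < μ) (b : ℝ) (x : X)
    (S : Set Θ) (p : Measure Θ) [IsProbabilityMeasure p] (hp : p Sᶜ = 0) :
    ENNReal.ofReal (M.decouplingGap b μ (fun θ x a => (M.trunc b θ x a - B.value x a) ^ 2) p x) ≤
      ENNReal.ofReal (1 / (4 * μ)) * M.dc x b S := by
  set c := M.decouplingGap b μ (fun θ x a => (M.trunc b θ x a - B.value x a) ^ 2) p x with hc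
  have hgm : Measurable fun θ => M.greedy θ x :=
    M.measurable_greedy.comp (f := fun θ : Θ => (θ, x)) (by fun_prop)
  have hsm : StronglyMeasurable fun a => ∫ θ, (M.trunc b θ x a - B.value x a) ^ 2 ∂p := by
    refine StronglyMeasurable.integral_prod_right'
      (f := fun q : A × Θ => (M.trunc b q.2 x q.1 - B.value x q.1) ^ 2) ?_
    have h1 := (M.measurable_trunc b).comp (f := fun q : A × Θ => (q.2, x, q.1)) (by fun_prop)
    have h2 := B.measurable_value.comp (f := fun q : A × Θ => (x, q.1)) (by fun_prop)
    exact ((h1.sub h2).pow_const 2).stronglyMeasurable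
  have h : ENNReal.ofReal (4 * μ * c) ≤ M.dc x b S := by
    refine le_iInf₂ fun K hK => ENNReal.ofReal_le_of_le_toReal ?_
    have h1 := hK p inferInstance hp μ hμ
    rw [integral_map hgm.aemeasurable hsm.aestronglyMeasurable] at h1
    have h2 : c ≤ K / (4 * μ) := by
      rw [hc, Model.decouplingGap, sub_le_iff_le_add']
      exact h1
    rw [le_div_iff₀ (by positivity)] at h2
    rw [ENNReal.coe_toReal]
    linarith
  calc ENNReal.ofReal c = ENNReal.ofReal (1 / (4 * μ)) * ENNReal.ofReal (4 * μ * c) := by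
        rw [← ENNReal.ofReal_mul (by positivity)]
        congr 1
        field_simp
    _ ≤ _ := mul_le_mul_right h _

/-- The expected regret of a round, corrected by the Feel-Good term and the squared error, is the
expectation of the decoupling gap of the posterior. The gap is a measurable function, so no
measurability is needed of its bound `κ`. -/
theorem Run.IsFeelGoodTS.ofReal_expRegret_le (hR : R.IsFeelGoodTS M η lam b prior Ω T P)
    (hopt : Measurable B.optValue) (hB : B.SubGaussianRewards) (hb : 1 ≤ b)
    (hu : M.IsErrorBound b u) {t : ℕ} (ht : t < T) (μ : ℝ) {κ : W → ℝ≥0∞}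
    (hκ : ∀ᵐ ω ∂P, ENNReal.ofReal
      (M.decouplingGap b μ u (R.post M η lam b prior Ω t ω) (R.x t ω)) ≤ κ ω) :
    ENNReal.ofReal (R.expRegret M P t + R.expFG M b P t
      - μ * R.expErr M η lam b prior Ω P u t) ≤ ∫⁻ ω, κ ω ∂P := by
  have hae := hR.aemeasurable_param ht
  have hpost := hR.ae_isProbabilityMeasure_post ht
  have hz : Measurable fun z : (History X A t × X) × Θ => (z.2, z.1.2) := by fun_prop
  have hopt' : Measurable fun z : (History X A t × X) × Θ => B.optValue z.1.2 :=
    hopt.comp (by fun_prop)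
  have hval : Measurable fun z : (History X A t × X) × Θ =>
      B.value z.1.2 (M.greedy z.2 z.1.2) :=
    B.measurable_value.comp (measurable_fst.snd.prodMk (M.measurable_greedy.comp hz))
  have htr : Measurable fun z : (History X A t × X) × Θ => M.truncMax b z.2 z.1.2 :=
    (M.measurable_truncMax b).comp hz
  -- the regret and the Feel-Good term
  have iopt : Integrable (fun ω => B.optValue (R.x t ω)) P :=
    Integrable.of_mem_Icc 0 1 (hopt'.comp_aemeasurable hae)
      (.of_forall fun ω => hB.optValue_mem (R.action_mem M t ω))
  have ival : Integrable (fun ω => B.value (R.x t ω) (R.action M t ω)) P :=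
    Integrable.of_mem_Icc 0 1 (hval.comp_aemeasurable hae)
      (.of_forall fun ω => (hB _ _ (R.action_mem M t ω)).2)
  have itr : Integrable (fun ω => M.truncMax b (R.θ t ω) (R.x t ω)) P :=
    Integrable.of_mem_Icc (-b) b (htr.comp_aemeasurable hae)
      (.of_forall fun ω => M.trunc_mem (by linarith) _ _ _)
  have e1 : R.expRegret M P t + R.expFG M b P t =
      ∫ ω, ∫ θ, (M.truncMax b θ (R.x t ω) - B.value (R.x t ω) (M.greedy θ (R.x t ω)))
        ∂(R.post M η lam b prior Ω t ω) ∂P := by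
    have h1 := integral_of_hasCondDistrib (hR.param t ht) (htr.sub hval) (itr.sub ival)
    refine Eq.trans ?_ h1
    refine (integral_add (iopt.sub ival) (itr.sub iopt)).symm.trans ?_
    refine integral_congr_ae (.of_forall fun ω => ?_)
    simp only [Run.action, Pi.sub_apply]
    ring
  have i1 : Integrable (fun ω => ∫ θ, (M.truncMax b θ (R.x t ω)
      - B.value (R.x t ω) (M.greedy θ (R.x t ω))) ∂(R.post M η lam b prior Ω t ω)) P := by
    have hm := M.measurable_integral_posterior (η := η) (lam := lam) (b := b) (prior := prior)
      (Ω := Ω t) measurable_id (htr.sub hval)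
    refine Integrable.of_bound (hm.comp_aemeasurable hae.fst).aestronglyMeasurable (b + 1) ?_
    filter_upwards [hpost] with ω hω
    refine abs_integral_le_of_abs_le fun θ => abs_le.2 ?_
    have k1 : M.truncMax b θ (R.x t ω) ∈ Set.Icc (-b) b := M.trunc_mem (by linarith) _ _ _
    have k2 := (hB _ _ (M.greedy_mem θ (R.x t ω))).2
    constructor <;> linarith [k1.1, k1.2, k2.1, k2.2]
  -- the squared error
  have hF : Measurable fun z : (History X A t × X) × Θ =>
      ∫ θ, u θ z.1.2 (M.greedy z.2 z.1.2) ∂(M.posterior η lam b prior t (Ω t) z.1) := by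
    refine M.measurable_integral_posterior (η := η) (lam := lam) (b := b) (prior := prior)
      (Ω := Ω t) (k := fun z : (History X A t × X) × Θ => z.1)
      (F := fun q => u q.2 q.1.1.2 (M.greedy q.1.2 q.1.1.2)) measurable_fst ?_
    exact hu.measurable.comp (measurable_snd.prodMk (measurable_fst.fst.snd.prodMk
      ((M.measurable_greedy.comp hz).comp measurable_fst)))
  have hbd : ∀ (p : Measure Θ) [IsProbabilityMeasure p] (x : X) (θ' : Θ),
      |∫ θ, u θ x (M.greedy θ' x) ∂p| ≤ (b + 1) ^ 2 := by
    intro p _ x θ'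
    refine abs_integral_le_of_abs_le fun θ => ?_
    have := hu.mem θ _ _ (M.greedy_mem θ' x)
    rw [abs_of_nonneg this.1]
    exact this.2
  have e2 : R.expErr M η lam b prior Ω P u t = ∫ ω, ∫ θ', ∫ θ,
      u θ (R.x t ω) (M.greedy θ' (R.x t ω)) ∂(R.post M η lam b prior Ω t ω)
        ∂(R.post M η lam b prior Ω t ω) ∂P := by
    refine integral_of_hasCondDistrib (hR.param t ht) hF
      (Integrable.of_bound (hF.comp_aemeasurable hae).aestronglyMeasurable ((b + 1) ^ 2) ?_)
    filter_upwards [hpost] with ω hω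
    exact hbd (R.post M η lam b prior Ω t ω) _ _
  have i2 : Integrable (fun ω => ∫ θ', ∫ θ,
      u θ (R.x t ω) (M.greedy θ' (R.x t ω)) ∂(R.post M η lam b prior Ω t ω)
        ∂(R.post M η lam b prior Ω t ω)) P := by
    have hm := M.measurable_integral_posterior (η := η) (lam := lam) (b := b) (prior := prior)
      (Ω := Ω t) measurable_id hF
    refine Integrable.of_bound (hm.comp_aemeasurable hae.fst).aestronglyMeasurable
      ((b + 1) ^ 2) ?_
    filter_upwards [hpost] with ω hω
    exact abs_integral_le_of_abs_le fun θ' => hbd (R.post M η lam b prior Ω t ω) _ _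
  have e3 : R.expRegret M P t + R.expFG M b P t - μ * R.expErr M η lam b prior Ω P u t =
      ∫ ω, M.decouplingGap b μ u (R.post M η lam b prior Ω t ω) (R.x t ω) ∂P := by
    rw [e1, e2, ← integral_const_mul, ← integral_sub i1 (i2.const_mul μ)]
    rfl
  rw [e3]
  have i3 : Integrable (fun ω =>
      M.decouplingGap b μ u (R.post M η lam b prior Ω t ω) (R.x t ω)) P :=
    i1.sub (i2.const_mul μ)
  calc _ ≤ ENNReal.ofReal (∫ ω, max (M.decouplingGap b μ u (R.post M η lam b prior Ω t ω)
          (R.x t ω)) 0 ∂P) :=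
        ENNReal.ofReal_le_ofReal (integral_mono i3 i3.pos_part fun ω => le_max_left _ _)
    _ ≤ ∫⁻ ω, ENNReal.ofReal (max (M.decouplingGap b μ u (R.post M η lam b prior Ω t ω)
          (R.x t ω)) 0) ∂P := ofReal_integral_le_lintegral fun ω => le_max_right _ _
    _ ≤ ∫⁻ ω, κ ω ∂P := by
        refine lintegral_mono_ae (hκ.mono fun ω hω => ?_)
        rwa [ENNReal.ofReal_max, ENNReal.ofReal_zero, max_eq_left zero_le]

/-! ### Linearly embeddable bandits -/

/-- The factor by which the error of `f(θ, x, ·)` is shrunk so that at the greedy action it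
becomes the error of the value function truncated at `1`. -/
def Model.shrinkFactor (M : Model Θ B) (θ : Θ) (x : X) : ℝ :=
  if M.maxValue θ x ≤ 1 then 1
  else (1 - B.value x (M.greedy θ x)) / (M.maxValue θ x - B.value x (M.greedy θ x))

/-- The shrunk error of `f(θ, x, ·)`. Unlike truncation, multiplication by a number that does not
depend on the action preserves linear embeddability. -/
def Model.shrunkError (M : Model Θ B) (θ : Θ) (x : X) (a : A) : ℝ :=
  M.shrinkFactor θ x * (M.f θ x a - B.value x a)

theorem Model.shrinkFactor_mem (M : Model Θ B) (hB : B.SubGaussianRewards) (θ : Θ) (x : X) :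
    M.shrinkFactor θ x ∈ Set.Icc (0 : ℝ) 1 := by
  have hv := (hB x _ (M.greedy_mem θ x)).2
  rw [Model.shrinkFactor]
  split_ifs with h
  · simp
  · push Not at h
    have h1 : 0 < M.maxValue θ x - B.value x (M.greedy θ x) := by linarith [hv.2]
    exact ⟨div_nonneg (by linarith [hv.2]) h1.le, (div_le_one h1).2 (by linarith)⟩

theorem Model.shrunkError_sq_le (M : Model Θ B) (hB : B.SubGaussianRewards) (θ : Θ) (x : X)
    (a : A) : M.shrunkError θ x a ^ 2 ≤ (M.f θ x a - B.value x a) ^ 2 := by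
  have h := M.shrinkFactor_mem hB θ x
  rw [Model.shrunkError, mul_pow]
  exact mul_le_of_le_one_left (sq_nonneg _) (pow_le_one₀ h.1 h.2)

theorem Model.shrunkError_greedy (M : Model Θ B) (hB : B.SubGaussianRewards) {θ : Θ} {x : X}
    (h : -1 ≤ M.maxValue θ x) : M.shrunkError θ x (M.greedy θ x) =
      M.truncMax 1 θ x - B.value x (M.greedy θ x) := by
  have hv := (hB x _ (M.greedy_mem θ x)).2
  change M.shrinkFactor θ x * (M.maxValue θ x - _) = max (-1) (min 1 (M.maxValue θ x)) - _
  rw [Model.shrinkFactor]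
  split_ifs with h1
  · rw [min_eq_right h1, max_eq_right h, one_mul]
  · push Not at h1
    rw [min_eq_left h1.le, max_eq_right (by norm_num : (-1 : ℝ) ≤ 1), div_mul_cancel₀]
    linarith [hv.2]

theorem Model.shrunkError_mem (M : Model Θ B) (hB : B.SubGaussianRewards) {θ : Θ} {x : X}
    {a : A} (ha : a ∈ B.actions x) (h : -1 ≤ M.f θ x a) :
    M.shrunkError θ x a ∈ Set.Icc (-2 : ℝ) 2 := by
  have hv := (hB x _ (M.greedy_mem θ x)).2
  have hva := (hB x a ha).2
  have hf : M.f θ x a ≤ M.maxValue θ x := M.le_greedy θ x a ha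
  have hα := M.shrinkFactor_mem hB θ x
  refine ⟨?_, ?_⟩
  · rw [Model.shrunkError]
    nlinarith [hα.1, hα.2, hva.1, hva.2]
  · rw [Model.shrunkError, Model.shrinkFactor]
    split_ifs with h1
    · linarith [hva.1]
    · push Not at h1
      rw [div_mul_eq_mul_div, div_le_iff₀ (by linarith [hv.2])]
      nlinarith [hv.1, hv.2, hva.1, hva.2,
        mul_nonneg hv.1 (by linarith : 0 ≤ M.maxValue θ x - 1)]

theorem Model.measurable_shrinkFactor (M : Model Θ B) :
    Measurable fun p : Θ × X => M.shrinkFactor p.1 p.2 := by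
  have h1 : Measurable fun p : Θ × X => B.value p.2 (M.greedy p.1 p.2) :=
    B.measurable_value.comp (measurable_snd.prodMk M.measurable_greedy)
  exact Measurable.ite (measurableSet_le M.measurable_maxValue measurable_const)
    measurable_const ((measurable_const.sub h1).div (M.measurable_maxValue.sub h1))

/-- The squared shrunk error bounds the squared error from below; the cap at `4` is inactive for
value functions above `-1`. -/
theorem Model.isErrorBound_shrunkError (M : Model Θ B) (hB : B.SubGaussianRewards) :
    M.IsErrorBound 1 fun θ x a => min (M.shrunkError θ x a ^ 2) 4 where
  measurable := by
    have h1 : Measurable fun p : Θ × X × A => M.shrinkFactor p.1 p.2.1 :=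
      M.measurable_shrinkFactor.comp (f := fun p : Θ × X × A => (p.1, p.2.1)) (by fun_prop)
    exact ((h1.mul (M.measurable_f.sub
      (B.measurable_value.comp measurable_snd))).pow_const 2).min measurable_const
  mem θ x a _ := ⟨le_min (sq_nonneg _) (by norm_num), (min_le_right _ _).trans (by norm_num)⟩
  le θ x a _ := (min_le_left _ _).trans (M.shrunkError_sq_le hB θ x a)

/-- For a linearly embeddable bandit the shrunk error is a kernel of rank at most `K`, so that the
dimension takes the place of the decoupling coefficient. -/
theorem Model.LinearlyEmbeddable.decouplingGap_le {K : ℕ} (hK : M.LinearlyEmbeddable K)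
    (hB : B.SubGaussianRewards) {μ : ℝ} (hμ : 0 < μ) {x : X} {S : Set Θ} {p : Measure Θ}
    [IsProbabilityMeasure p] (hp : p Sᶜ = 0)
    (hS : ∀ θ ∈ S, ∀ a ∈ B.actions x, -1 ≤ M.f θ x a) :
    M.decouplingGap 1 μ (fun θ x a => min (M.shrunkError θ x a ^ 2) 4) p x ≤ K / (4 * μ) := by
  obtain ⟨φ, w, wstar, hφ, hw, hlin⟩ := hK
  have hpS : ∀ᵐ θ ∂p, θ ∈ S := hp
  set v : Θ → Fin K → ℝ := fun θ => WithLp.ofLp (M.shrinkFactor θ x • (w θ x - wstar x)) with hv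
  set z : Θ → Fin K → ℝ := fun θ => WithLp.ofLp (φ x (M.greedy θ x)) with hz
  have hofLp : Measurable (WithLp.ofLp : EuclideanSpace ℝ (Fin K) → Fin K → ℝ) :=
    (PiLp.continuous_ofLp 2 _).measurable
  have hgm : Measurable fun θ => M.greedy θ x :=
    M.measurable_greedy.comp (f := fun θ : Θ => (θ, x)) (by fun_prop)
  have hvm : Measurable v := hofLp.comp
    ((M.measurable_shrinkFactor.comp (f := fun θ : Θ => (θ, x)) (by fun_prop)).smul
      ((hw x).sub_const _))
  have hzm : Measurable z := hofLp.comp ((hφ x).comp hgm)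
  have hdot : ∀ θ θ', z θ' ⬝ᵥ v θ = M.shrunkError θ x (M.greedy θ' x) := by
    intro θ θ'
    have h1 := hlin x _ (M.greedy_mem θ' x)
    have h2 : z θ' ⬝ᵥ v θ =
        inner ℝ (M.shrinkFactor θ x • (w θ x - wstar x)) (φ x (M.greedy θ' x)) := by
      rw [EuclideanSpace.inner_eq_star_dotProduct, star_trivial]
    rw [h2, inner_smul_left, inner_sub_left, ← h1.1 θ, ← h1.2]
    rfl
  have hbd : ∀ θ' ∈ S, ∀ θ ∈ S, |z θ' ⬝ᵥ v θ| ≤ 2 := fun θ' _ θ hθ => by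
    rw [hdot, abs_le]
    exact M.shrunkError_mem hB (M.greedy_mem θ' x) (hS θ hθ _ (M.greedy_mem θ' x))
  have key := integral_dotProduct_le hzm hvm hp hbd hμ
  have e1 : ∫ θ, z θ ⬝ᵥ v θ ∂p =
      ∫ θ, (M.truncMax 1 θ x - B.value x (M.greedy θ x)) ∂p := by
    refine integral_congr_ae (hpS.mono fun θ hθ => ?_)
    simp only [hdot]
    exact M.shrunkError_greedy hB (hS θ hθ _ (M.greedy_mem θ x))
  have e2 : ∫ θ', ∫ θ, (z θ' ⬝ᵥ v θ) ^ 2 ∂p ∂p =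
      ∫ θ', ∫ θ, min (M.shrunkError θ x (M.greedy θ' x) ^ 2) 4 ∂p ∂p := by
    refine integral_congr_ae (.of_forall fun θ' => integral_congr_ae (hpS.mono fun θ hθ => ?_))
    simp only [hdot]
    have := M.shrunkError_mem hB (M.greedy_mem θ' x) (hS θ hθ _ (M.greedy_mem θ' x))
    rw [min_eq_left]
    nlinarith [this.1, this.2]
  rw [e1, e2, Fintype.card_fin] at key
  rw [Model.decouplingGap, sub_le_iff_le_add']
  exact key

end Regret

/-! ### The regret bounds -/

theorem coe_le_coe_ennreal_add {x r : ℝ} {D : ℝ≥0∞} (h : ENNReal.ofReal (x - r) ≤ D) :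
    (x : EReal) ≤ (D : EReal) + (r : EReal) := by
  rw [← EReal.sub_le_iff_le_add (by simp) (by simp)]
  calc (x : EReal) - r = ((x - r : ℝ) : EReal) := (EReal.coe_sub _ _).symm
    _ ≤ (ENNReal.ofReal (x - r) : EReal) := by
      rw [EReal.coe_ennreal_ofReal]
      exact EReal.coe_le_coe_iff.2 (le_max_left _ _)
    _ ≤ D := EReal.coe_ennreal_le_coe_ennreal_iff.2 h

theorem add_le_add_sub_div {D Z : EReal} {r c S lam : ℝ} (hlam : 0 < lam) (hZ : Z ≤ (S : EReal))
    (h : r + S / lam ≤ c) : D + (r : EReal) ≤ D + (c : EReal) - Z / (lam : EReal) := by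
  calc D + (r : EReal) ≤ D + ((c - S / lam : ℝ) : EReal) :=
        add_le_add_right (EReal.coe_le_coe_iff.2 (by linarith)) _
    _ = D + (c : EReal) - (S : EReal) / (lam : EReal) := by
        rw [EReal.coe_sub, EReal.coe_div, sub_eq_add_neg, sub_eq_add_neg, add_assoc]
    _ ≤ _ := EReal.sub_le_sub le_rfl
        (EReal.div_le_div_right_of_nonneg (EReal.coe_nonneg.2 hlam.le) hZ)

end FeelGood

end

theorem mainTheorem1 {Θ X A W : Type*} [MeasurableSpace Θ] [MeasurableSpace X]
    [MeasurableSpace A] [MeasurableSpace W]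
    (B : FeelGood.Bandit X A) (M : FeelGood.Model Θ B)
    (hopt : Measurable B.optValue) (hB : B.SubGaussianRewards)
    (prior : Measure Θ) [IsProbabilityMeasure prior]
    (b η lam : ℝ) (hb : 1 ≤ b) (hη : 0 < η) (hηb : η ≤ 1 / (b + 1) ^ 2) (hlam : 0 < lam)
    (Ω : (t : ℕ) → FeelGood.History X A t → X → Set Θ)
    (hΩ : ∀ t, MeasurableSet {p : (FeelGood.History X A t × X) × Θ | p.2 ∈ Ω t p.1.1 p.1.2})
    (T : ℕ) (P : Measure W) [IsProbabilityMeasure P] (R : FeelGood.Run Θ X W)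
    (hR : R.IsFeelGoodTS M η lam b prior Ω T P)
    (hnested : ∀ t < T, ∀ᵐ ω ∂P,
      Ω t (R.hist M t ω) (R.x t ω) ⊆ FeelGood.activeSet Ω t (R.hist M t ω)) :
    -- the expected log-partition function is well defined, with values in `[-∞, ∞)`
    (∫⁻ ω, ENNReal.ofReal (M.logPartition η lam b prior Ω T (R.hist M T ω)) ∂P ≠ ⊤) ∧
    -- the two inequalities
    ((∑ t ∈ Finset.range T, R.expRegret M P t : ℝ) : EReal) ≤
      ((lam / η : ℝ) : EReal) * (R.expDC M b Ω P T : EReal)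
        + ((0.25 * η / lam * ∑ t ∈ Finset.range T, R.expLS M η lam b prior Ω P t
            - ∑ t ∈ Finset.range T, R.expFG M b P t : ℝ) : EReal) ∧
    ((lam / η : ℝ) : EReal) * (R.expDC M b Ω P T : EReal)
        + ((0.25 * η / lam * ∑ t ∈ Finset.range T, R.expLS M η lam b prior Ω P t
            - ∑ t ∈ Finset.range T, R.expFG M b P t : ℝ) : EReal) ≤
      ((lam / η : ℝ) : EReal) * (R.expDC M b Ω P T : EReal)
        + ((1.5 * lam * (b + 1) ^ 2 * T : ℝ) : EReal)
        - FeelGood.extExp P (fun ω => M.logPartition η lam b prior Ω T (R.hist M T ω))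
            / (lam : EReal) ∧
    -- linearly embeddable bandits
    (b = 1 → η = 1 / 4 → ∀ K : ℕ, M.LinearlyEmbeddable K →
      (∀ t < T, ∀ᵐ ω ∂P, ∀ θ ∈ Ω t (R.hist M t ω) (R.x t ω), ∀ a ∈ B.actions (R.x t ω),
        -b ≤ M.f θ (R.x t ω) a) →
      ((∑ t ∈ Finset.range T, R.expRegret M P t : ℝ) : EReal) ≤
        ((4 * (K + 2) * T * lam : ℝ) : EReal)
          - FeelGood.extExp P (fun ω => M.logPartition η lam b prior Ω T (R.hist M T ω))
              / (lam : EReal)) := by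
  have hLS : ∀ t, R.expLS M η lam b prior Ω P t = R.expErr M η lam b prior Ω P
      (fun θ x a => (M.trunc b θ x a - B.value x a) ^ 2) t := fun t => rfl
  have hμ : 0 < 0.25 * η / lam := by positivity
  have hμ' : 1 / (4 * (0.25 * η / lam)) = lam / η := by field_simp; norm_num
  have hZ := hR.extExp_logPartition_le hopt hB hb hη hηb hlam hΩ hnested
    (M.isErrorBound_trunc hB hb)
  refine ⟨hZ.1, ?_, ?_, ?_⟩
  · have hcoe : ((lam / η : ℝ) : EReal) * (R.expDC M b Ω P T : EReal) =
        ((ENNReal.ofReal (lam / η) * R.expDC M b Ω P T : ℝ≥0∞) : EReal) := by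
      rw [EReal.coe_ennreal_mul, EReal.coe_ennreal_ofReal, max_eq_left (by positivity)]
    rw [hcoe]
    refine FeelGood.coe_le_coe_ennreal_add ?_
    have hsum : ∑ t ∈ Finset.range T, R.expRegret M P t
        - (0.25 * η / lam * ∑ t ∈ Finset.range T, R.expLS M η lam b prior Ω P t
          - ∑ t ∈ Finset.range T, R.expFG M b P t) =
        ∑ t ∈ Finset.range T, (R.expRegret M P t + R.expFG M b P t
          - 0.25 * η / lam * R.expLS M η lam b prior Ω P t) := by
      rw [Finset.sum_sub_distrib, Finset.sum_add_distrib, Finset.mul_sum]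
      ring
    rw [hsum, FeelGood.Run.expDC, Finset.mul_sum]
    refine (Finset.le_sum_of_subadditive ENNReal.ofReal ENNReal.ofReal_zero.le
      (fun _ _ => ENNReal.ofReal_add_le) _ _).trans (Finset.sum_le_sum fun t ht => ?_)
    have ht' := Finset.mem_range.1 ht
    rw [hLS, ← lintegral_const_mul' _ _ ENNReal.ofReal_ne_top]
    refine hR.ofReal_expRegret_le hopt hB hb (M.isErrorBound_trunc hB hb) ht' _ ?_
    filter_upwards [hR.ae_isProbabilityMeasure_post ht'] with ω hω
    rw [← hμ']
    exact M.ofReal_decouplingGap_le_dc hμ b _ _ _ (M.posterior_compl (hΩ t) _ _)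
  · refine FeelGood.add_le_add_sub_div hlam hZ.2 (le_of_eq ?_)
    simp_rw [← hLS]
    rw [Finset.sum_add_distrib, Finset.sum_sub_distrib, ← Finset.mul_sum, ← Finset.mul_sum]
    simp only [Finset.sum_const, Finset.card_range, nsmul_eq_mul]
    field_simp
    ring
  · rintro rfl rfl K hK hneg
    have hZ' := hR.extExp_logPartition_le hopt hB hb hη hηb hlam hΩ hnested
      (M.isErrorBound_shrunkError hB)
    -- the decoupling inequality for the shrunk error, in each round
    have hround : ∀ t ∈ Finset.range T, R.expRegret M P t + R.expFG M 1 P t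
        - 0.25 * (1 / 4) / lam * R.expErr M (1 / 4) lam 1 prior Ω P
          (fun θ x a => min (M.shrunkError θ x a ^ 2) 4) t ≤ 4 * lam * K := by
      intro t ht
      have ht' := Finset.mem_range.1 ht
      have h := hR.ofReal_expRegret_le hopt hB hb (M.isErrorBound_shrunkError hB) ht'
        (0.25 * (1 / 4) / lam) (κ := fun _ => ENNReal.ofReal (4 * lam * K)) (by
          filter_upwards [hR.ae_isProbabilityMeasure_post ht', hneg t ht'] with ω hω h1
          refine ENNReal.ofReal_le_ofReal ((hK.decouplingGap_le hB hμ
            (p := R.post M (1 / 4) lam 1 prior Ω t ω) (M.posterior_compl (hΩ t) _ _) h1).trans_eq ?_)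
          rw [div_eq_mul_one_div, hμ']
          ring)
      rw [lintegral_const, measure_univ, mul_one,
        ENNReal.ofReal_le_ofReal_iff (by positivity)] at h
      exact h
    -- The rank contributes `4 * lam * K` per round since `lam / η = 4 * lam`, and the exponential
    -- moment bound contributes `1.5 * lam * (1 + 1) ^ 2 = 6 * lam ≤ 8 * lam`.
    have h3 := Finset.sum_le_sum hround
    have h4 := FeelGood.add_le_add_sub_div (D := 0)
      (r := ∑ t ∈ Finset.range T, R.expRegret M P t) (c := 4 * (K + 2) * T * lam) hlam hZ'.2 ?_
    · simpa only [zero_add] using h4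
    · rw [Finset.sum_sub_distrib, Finset.sum_add_distrib, ← Finset.mul_sum] at h3
      rw [Finset.sum_add_distrib, Finset.sum_sub_distrib, ← Finset.mul_sum, ← Finset.mul_sum]
      simp only [Finset.sum_const, Finset.card_range, nsmul_eq_mul] at h3 ⊢
      have h5 : (0 : ℝ) ≤ T * lam := by positivity
      have h6 : (lam * ∑ t ∈ Finset.range T, R.expFG M 1 P t
          - 0.25 * (1 / 4) * ∑ t ∈ Finset.range T, R.expErr M (1 / 4) lam 1 prior Ω P
            (fun θ x a => min (M.shrunkError θ x a ^ 2) 4) t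
          + T * (1.5 * lam ^ 2 * (1 + 1) ^ 2)) / lam =
        ∑ t ∈ Finset.range T, R.expFG M 1 P t
          - 0.25 * (1 / 4) / lam * ∑ t ∈ Finset.range T, R.expErr M (1 / 4) lam 1 prior Ω P
            (fun θ x a => min (M.shrunkError θ x a ^ 2) 4) t + 6 * (T * lam) := by
        field_simp
        ring
      rw [h6]
      linarith
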